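/- Let $n\ge 2$, let $-L=-\big(\mathrm i\,\mathrm{ad}_{H_0}+\sum_{k=1}^r\Gamma_{V_k}\big)$ be a Kossakowski--Lindblad generator on $\mathbb C^{n\times n}$, where $H_0$ is Hermitian, $V_1,\dots,V_r\in\mathbb C^{n\times n}$ are arbitrary, $\mathrm{ad}_{H}(\rho)=H\rho-\rho H$ and $\Gamma_V(\rho)=\tfrac12(V^*V\rho+\rho V^*V)-V\rho V^*$. For $U\in\mathrm U(n)$ let $-L_U$ be the linear map on $\mathbb R^n$ sending $\lambda$ to the diagonal of $-U^*L(U\,\mathrm{diag}(\lambda)\,U^*)U$. Put $\mathfrak L=\{-L_U:U\in\mathrm{SU}(n)\}$ and $\mathsf{derv}(\lambda)=\mathfrak L\lambda$. Let $\Delta^{n-1}\subset\mathbb R^n$ be the standard simplex. A point $\lambda\in\Delta^{n-1}$ is *stabilizable* if $0\in\operatorname{conv}(\mathsf{derv}(\lambda))$, and *strongly stabilizable* if $0\in\mathsf{derv}(\lambda)$. A set $F\subseteq\Delta^{n-1}$ is *viable* (for the relaxed system) if for each $\lambda_0\in F$ there is a locally absolutely continuous $\lambda:[0,\infty)\to F$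 with $\lambda(0)=\lambda_0$ and $\dot\lambda(t)\in\operatorname{conv}(\mathsf{derv}(\lambda(t)))$ for almost every $t$. A vector is *tangent* to a face $F$ if it lies in the linear space parallel to the affine hull of $F$. A viable face $F$ is *purely Hamiltonian* if every element of $\mathfrak L$ whose restriction to $F$ is tangent to $F$ vanishes on $F$. A nonzero subspace $S\subseteq\mathbb C^n$ is *lazy* if it is invariant under the unital algebra generated by the $V_k$, and *collecting* for the generator given by $H_0$ and the $V_k$ if it is also invariant under $K=\mathrm iH_0+\frac12\sum_kV_k^*V_k$. A Hermitian $H_S$ is a *stabilizing Hamiltonian* for $S$ if $S$ is collecting for $-(\mathrm i\,\mathrm{ad}_{H_S}+L)$, i.e. with $H_0$ replaced by $H_0+H_S$. A *state* is a positive semidefinite matrix of trace one, and its support is its range. Let $F$ be a face of $\Delta^{n-1}$ of dimension $d-1$, $1\le d\le n$. Consider the conditions: 1. $F$ is viable for the relaxed system. 2. There is some $-M\in\operatorname{conv}(\mathfrak L)$ whose (forward) flow leaves $F$ invariant. 3. There is a lazy subspace of dimension $d$. 4. There is a stabilizable point in the relative interior of $F$. 5. There is a strongly stabilizable point in the relative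 interior of $F$. 6. There are $-M\in\operatorname{conv}(\mathfrak L)$ and $\lambda$ in the relative interior of $F$ such that $-M\lambda$ is tangent to $F$. 7. There are $U\in\mathrm U(n)$ and $\lambda$ in the relative interior of $F$ such that $-L_U\lambda$ is tangent to $F$. 8. There are a state $\rho$ of rank $d$ and a stabilizing Hamiltonian $H_S$ for $S=\operatorname{supp}\rho$ such that $\rho$ is a fixed point of $-(\mathrm i\,\mathrm{ad}_{H_S}+L)$ and is the only fixed point among the states supported in $\operatorname{supp}\rho$. If $d=1$ or $F$ is not purely Hamiltonian, then conditions 1--8 are equivalent. In every case, conditions 1--7 are equivalent to each other and to condition 8 without the uniqueness requirement (that is, requiring only that $\rho$ be a fixed point). -/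

import Mathlib

noncomputable section

namespace GKSL

open Matrix MeasureTheory
open scoped ComplexOrder

variable {n r : ℕ}

/-! ### Kossakowski–Lindblad generators -/

/-- The superoperator `i ad_H : ρ ↦ i [H, ρ]`. -/
def iAd (H : Matrix (Fin n) (Fin n) ℂ) :
    Matrix (Fin n) (Fin n) ℂ →ₗ[ℂ] Matrix (Fin n) (Fin n) ℂ where
  toFun ρ := Complex.I • (H * ρ - ρ * H)
  map_add' x y := by rw [← smul_add, mul_add, add_mul, add_sub_add_comm]
  map_smul' c x := by
    simp only [mul_smul_comm, smul_mul_assoc, RingHom.id_apply]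
    rw [← smul_sub, smul_comm]

/-- The superoperator `Γ_V : ρ ↦ ½ (V* V ρ + ρ V* V) - V ρ V*`. -/
def dissipator (V : Matrix (Fin n) (Fin n) ℂ) :
    Matrix (Fin n) (Fin n) ℂ →ₗ[ℂ] Matrix (Fin n) (Fin n) ℂ where
  toFun ρ := (1 / 2 : ℂ) • (Vᴴ * V * ρ + ρ * (Vᴴ * V)) - V * ρ * Vᴴ
  map_add' x y := by
    simp only [mul_add, add_mul, smul_add]
    abel
  map_smul' c x := by
    simp only [mul_smul_comm, smul_mul_assoc, RingHom.id_apply, smul_sub, smul_add]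
    rw [smul_comm c, smul_comm c]

/-- `L = i ad_{H₀} + ∑ₖ Γ_{Vₖ}`. The Kossakowski–Lindblad generator is `-L`. -/
def lindblad (H₀ : Matrix (Fin n) (Fin n) ℂ) (V : Fin r → Matrix (Fin n) (Fin n) ℂ) :
    Matrix (Fin n) (Fin n) ℂ →ₗ[ℂ] Matrix (Fin n) (Fin n) ℂ :=
  iAd H₀ + ∑ k, dissipator (V k)

/-- States, i.e. density matrices. -/
def IsState (ρ : Matrix (Fin n) (Fin n) ℂ) : Prop :=
  ρ.PosSemidef ∧ ρ.trace = 1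

/-- The support of a Hermitian matrix is its range. -/
def supp (ρ : Matrix (Fin n) (Fin n) ℂ) : Submodule ℂ (Fin n → ℂ) :=
  LinearMap.range ρ.mulVecLin

/-! ### Relaxation algebras, lazy and collecting subspaces -/

/-- The relaxation algebra: the unital matrix algebra generated by the Lindblad terms. -/
def relaxationAlgebra (V : Fin r → Matrix (Fin n) (Fin n) ℂ) :
    Subalgebra ℂ (Matrix (Fin n) (Fin n) ℂ) :=
  Algebra.adjoin ℂ (Set.range V)

/-- The extended relaxation algebra, additionally generated by `K = i H₀ + ½ ∑ₖ Vₖ* Vₖ`. -/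
def extendedRelaxationAlgebra (H₀ : Matrix (Fin n) (Fin n) ℂ)
    (V : Fin r → Matrix (Fin n) (Fin n) ℂ) : Subalgebra ℂ (Matrix (Fin n) (Fin n) ℂ) :=
  Algebra.adjoin ℂ
    (insert (Complex.I • H₀ + (1 / 2 : ℂ) • ∑ k, (V k)ᴴ * V k) (Set.range V))

/-- `S` is invariant under every matrix of the algebra `A`. -/
def IsInvariantSubspace (A : Subalgebra ℂ (Matrix (Fin n) (Fin n) ℂ))
    (S : Submodule ℂ (Fin n → ℂ)) : Prop :=
  ∀ M ∈ A, ∀ x ∈ S, M *ᵥ x ∈ S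

/-- Lazy subspaces: nonzero invariant subspaces of the relaxation algebra. -/
def IsLazy (V : Fin r → Matrix (Fin n) (Fin n) ℂ) (S : Submodule ℂ (Fin n → ℂ)) : Prop :=
  S ≠ ⊥ ∧ IsInvariantSubspace (relaxationAlgebra V) S

/-- Collecting subspaces: nonzero invariant subspaces of the extended relaxation algebra. -/
def IsCollecting (H₀ : Matrix (Fin n) (Fin n) ℂ) (V : Fin r → Matrix (Fin n) (Fin n) ℂ)
    (S : Submodule ℂ (Fin n → ℂ)) : Prop :=
  S ≠ ⊥ ∧ IsInvariantSubspace (extendedRelaxationAlgebra H₀ V) S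

/-- `H` is a stabilizing Hamiltonian for `S`: adding `H` to the Hamiltonian, i.e. passing from
`-L` to `-(i ad_H + L)`, makes `S` collecting. -/
def IsStabilizingHamiltonian (H₀ : Matrix (Fin n) (Fin n) ℂ)
    (V : Fin r → Matrix (Fin n) (Fin n) ℂ) (S : Submodule ℂ (Fin n → ℂ))
    (H : Matrix (Fin n) (Fin n) ℂ) : Prop :=
  H.IsHermitian ∧ IsCollecting (H₀ + H) V S

/-! ### The reduced control system on the simplex, for a superoperator `L` -/

section Reduced

variable (L : Matrix (Fin n) (Fin n) ℂ →ₗ[ℂ] Matrix (Fin n) (Fin n) ℂ)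

/-- The linear map `-L_U : λ ↦ - diag (U* L(U diag(λ) U*) U)`; for the generators considered here
the diagonal entries are real. -/
def inducedMap (U : Matrix (Fin n) (Fin n) ℂ) : (Fin n → ℝ) →ₗ[ℝ] (Fin n → ℝ) where
  toFun x i := -((Uᴴ * L (U * diagonal (fun j => (x j : ℂ)) * Uᴴ) * U) i i).re
  map_add' x y := by
    have h : diagonal (fun j => ((x + y) j : ℂ))
        = diagonal (fun j => (x j : ℂ)) + diagonal (fun j => (y j : ℂ)) := by
      rw [diagonal_add]; congr 1; funext j; simp
    funext i
    rw [h]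
    simp only [mul_add, add_mul, map_add, Matrix.add_apply, Complex.add_re, Pi.add_apply]
    ring
  map_smul' c x := by
    have h : diagonal (fun j => ((c • x) j : ℂ))
        = (c : ℂ) • diagonal (fun j => (x j : ℂ)) := by
      rw [← diagonal_smul]; congr 1; funext j; simp
    funext i
    rw [h]
    simp

/-- The matrix of the induced vector field `-L_U`. -/
def inducedField (U : Matrix (Fin n) (Fin n) ℂ) : Matrix (Fin n) (Fin n) ℝ :=
  LinearMap.toMatrix' (inducedMap L U)

/-- `𝔏 = {-L_U : U ∈ SU(n)}`. -/
def inducedFields : Set (Matrix (Fin n) (Fin n) ℝ) :=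
  {X | ∃ U ∈ specialUnitaryGroup (Fin n) ℂ, X = inducedField L U}

/-- The achievable derivatives `derv(x) = 𝔏 x`. -/
def derv (x : Fin n → ℝ) : Set (Fin n → ℝ) :=
  {v | ∃ X ∈ inducedFields L, v = X *ᵥ x}

/-- The point `x` is stabilizable. -/
def IsStabilizable (x : Fin n → ℝ) : Prop :=
  x ∈ stdSimplex ℝ (Fin n) ∧ (0 : Fin n → ℝ) ∈ convexHull ℝ (derv L x)

/-- The point `x` is strongly stabilizable. -/
def IsStronglyStabilizable (x : Fin n → ℝ) : Prop :=
  x ∈ stdSimplex ℝ (Fin n) ∧ (0 : Fin n → ℝ) ∈ derv L x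

/-- Solutions on `[0, ∞)` of the relaxed system `ẋ(t) ∈ conv (derv (x(t)))`: (locally) absolutely
continuous functions with values in the simplex that satisfy the inclusion almost everywhere. Only
the values of `x` on `[0, ∞)` matter. -/
def IsRelaxedSolution (x : ℝ → Fin n → ℝ) : Prop :=
  (∀ t, 0 ≤ t → x t ∈ stdSimplex ℝ (Fin n)) ∧
  (∀ T, 0 ≤ T → AbsolutelyContinuousOnInterval x 0 T) ∧
  ∀ᵐ t ∂(volume.restrict (Set.Ici (0 : ℝ))),
    ∃ v ∈ convexHull ℝ (derv L (x t)), HasDerivAt x v t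

/-- `F` is viable for the relaxed system. -/
def IsViable (F : Set (Fin n → ℝ)) : Prop :=
  ∀ x₀ ∈ F, ∃ x : ℝ → Fin n → ℝ,
    IsRelaxedSolution L x ∧ x 0 = x₀ ∧ ∀ t, 0 ≤ t → x t ∈ F

/-- The flow `t ↦ exp(t X)` (`t ≥ 0`) of the linear vector field `X` leaves `F` invariant. -/
def FlowLeavesInvariant (X : Matrix (Fin n) (Fin n) ℝ) (F : Set (Fin n → ℝ)) : Prop :=
  ∀ t : ℝ, 0 ≤ t → ∀ x ∈ F, NormedSpace.exp (t • X) *ᵥ x ∈ F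

/-- The vector `v` is tangent to `F`: it lies in the direction of the affine hull of `F`. -/
def IsTangent (F : Set (Fin n → ℝ)) (v : Fin n → ℝ) : Prop :=
  v ∈ vectorSpan ℝ F

/-- The `(d-1)`-dimensional faces of the standard simplex: the points of the simplex whose
coordinates vanish outside a set of `d ≥ 1` indices. -/
def IsFace (d : ℕ) (F : Set (Fin n → ℝ)) : Prop :=
  1 ≤ d ∧ ∃ I : Finset (Fin n), I.card = d ∧
    F = {x | x ∈ stdSimplex ℝ (Fin n) ∧ ∀ i, i ∉ I → x i = 0}

/-- A viable face `F` is purely Hamiltonian if every induced vector field whose restriction to `F`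
is tangent to `F` vanishes on `F`. -/
def IsPurelyHamiltonianFace (F : Set (Fin n → ℝ)) : Prop :=
  IsViable L F ∧ ∀ X ∈ inducedFields L,
    (∀ x ∈ F, IsTangent F (X *ᵥ x)) → ∀ x ∈ F, X *ᵥ x = 0

end Reduced

end GKSL

end

open GKSL Matrix

noncomputable section

namespace GKSL

open Matrix MeasureTheory
open scoped ComplexOrder


variable {n r d : ℕ}

/-! ### Transition rates -/

section Rates

variable {m ι : Type*} [Fintype ι]

/-! In the basis given by `U`, the diagonal part of the generator is a classical Markov generator
with rates `J i j = ∑ₖ |(U* Vₖ U) i j|²` from `j` to `i`; the Hamiltonian drops out. At a point in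
the relative interior of the face with index set `I`, the coordinates outside `I` have no outflow
and nonnegative inflow. They stay at rest only if every rate from `I` to its complement vanishes,
that is, only if the columns of `U` indexed by `I` span a lazy subspace
(`reduces_of_mulVec_eq_zero`). Convex combinations gain nothing, because the total inflow into the
complement is a linear functional, nonnegative on `𝔏` (`exists_reduces_of_convexHull`). Hence each
of the conditions on the simplex yields a lazy subspace of dimension `d`.

Conversely, let `E` be an isometry onto a lazy subspace and `B k` the compressed Lindblad terms.
Every Hermitian `h` on `ℂ^d` is induced by a stabilizing Hamiltonian (`exists_stabilizing`), so it
suffices to find `h` for which the compressed generator fixes a positive definite state. If some `B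
k` has a nonzero off-diagonal entry, then for a suitable `h` the operator `K` and the `B k` generate
all matrices (`exists_hermitian_adjoin_eq_top`), and such an irreducible generator has exactly one
fixed state, which is faithful (`exists_unique_fixed`). If all `B k` are diagonal, the maximally
mixed state is fixed, but uniqueness may fail.

Diagonalizing the lifted state gives a strongly stabilizable interior point and an induced field
whose flow preserves the face, closing the cycle. For uniqueness with `d ≥ 2`, a tangent field that
does not vanish on the face supplies the off-diagonal entry. -/

/-- The transition rates `|(Wₖ)ᵢⱼ|²`, summed over `k`. -/
def jumpRate (W : ι → Matrix m m ℂ) (i j : m) : ℝ := ∑ k, Complex.normSq (W k i j)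

theorem jumpRate_nonneg (W : ι → Matrix m m ℂ) (i j : m) : 0 ≤ jumpRate W i j :=
  Finset.sum_nonneg fun _ _ => Complex.normSq_nonneg _

theorem jumpRate_eq_zero_iff {W : ι → Matrix m m ℂ} {i j : m} :
    jumpRate W i j = 0 ↔ ∀ k, W k i j = 0 := by
  rw [jumpRate, Finset.sum_eq_zero_iff_of_nonneg fun _ _ => Complex.normSq_nonneg _]
  simp

end Rates

/-! ### Generators in terms of `K` -/

section Generator

variable {m l ι : Type*} [Fintype m] [Fintype l] [Fintype ι]

/-- The superoperator `ρ ↦ K ρ + ρ K* - ∑ₖ Vₖ ρ Vₖ*`. -/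
def generator (K : Matrix m m ℂ) (V : ι → Matrix m m ℂ) (ρ : Matrix m m ℂ) : Matrix m m ℂ :=
  K * ρ + ρ * Kᴴ - ∑ k, V k * ρ * (V k)ᴴ

theorem generator_add (K : Matrix m m ℂ) (V : ι → Matrix m m ℂ) (ρ σ : Matrix m m ℂ) :
    generator K V (ρ + σ) = generator K V ρ + generator K V σ := by
  simp only [generator, mul_add, add_mul, Finset.sum_add_distrib]
  abel

theorem generator_smul (K : Matrix m m ℂ) (V : ι → Matrix m m ℂ) (c : ℂ) (ρ : Matrix m m ℂ) :
    generator K V (c • ρ) = c • generator K V ρ := by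
  simp only [generator, mul_smul_comm, smul_mul_assoc, smul_sub, smul_add, Finset.smul_sum]

/-- The generator as a linear map. -/
def generatorLin (K : Matrix m m ℂ) (V : ι → Matrix m m ℂ) : Matrix m m ℂ →ₗ[ℂ] Matrix m m ℂ where
  toFun := generator K V
  map_add' := generator_add K V
  map_smul' := generator_smul K V

theorem generator_conjTranspose (K : Matrix m m ℂ) (V : ι → Matrix m m ℂ) (ρ : Matrix m m ℂ) :
    generator K V ρᴴ = (generator K V ρ)ᴴ := by
  simp only [generator, conjTranspose_sub, conjTranspose_add, conjTranspose_mul,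
    conjTranspose_conjTranspose, conjTranspose_sum, Matrix.mul_assoc]
  rw [add_comm]

/-- The relation between `K` and the Lindblad terms is exactly trace preservation, by cyclicity of
the trace. -/
theorem trace_generator {K : Matrix m m ℂ} {V : ι → Matrix m m ℂ}
    (hK : K + Kᴴ = ∑ k, (V k)ᴴ * V k) (ρ : Matrix m m ℂ) : (generator K V ρ).trace = 0 := by
  have h : ∀ k, (V k * ρ * (V k)ᴴ).trace = ((V k)ᴴ * V k * ρ).trace := fun k => by
    rw [trace_mul_comm, Matrix.mul_assoc]
  rw [generator, trace_sub, trace_add, trace_mul_comm ρ, ← trace_add, ← add_mul, hK, trace_sum,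
    Finset.sum_mul, trace_sum, sub_eq_zero]
  exact Finset.sum_congr rfl fun k _ => (h k).symm

/-- Intertwining along an isometry. -/
theorem generator_isometry {K : Matrix m m ℂ} {V : ι → Matrix m m ℂ} {E : Matrix m l ℂ}
    {k : Matrix l l ℂ} {B : ι → Matrix l l ℂ}
    (hV : ∀ a, V a * E = E * B a) (hK : K * E = E * k) (σ : Matrix l l ℂ) :
    generator K V (E * σ * Eᴴ) = E * generator k B σ * Eᴴ := by
  have hV' : ∀ a, Eᴴ * (V a)ᴴ = (B a)ᴴ * Eᴴ := fun a => by
    rw [← conjTranspose_mul, hV, conjTranspose_mul]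
  have hK' : Eᴴ * Kᴴ = kᴴ * Eᴴ := by rw [← conjTranspose_mul, hK, conjTranspose_mul]
  have h1 : K * (E * σ * Eᴴ) = E * (k * σ) * Eᴴ := by
    rw [← Matrix.mul_assoc, ← Matrix.mul_assoc, hK]; simp only [Matrix.mul_assoc]
  have h2 : E * σ * Eᴴ * Kᴴ = E * (σ * kᴴ) * Eᴴ := by
    rw [Matrix.mul_assoc, hK']; simp only [Matrix.mul_assoc]
  have h3 : ∀ a, V a * (E * σ * Eᴴ) * (V a)ᴴ = E * (B a * σ * (B a)ᴴ) * Eᴴ := fun a => by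
    rw [← Matrix.mul_assoc, ← Matrix.mul_assoc, hV, Matrix.mul_assoc (E * B a * σ), hV']
    simp only [Matrix.mul_assoc]
  rw [generator, generator, h1, h2, Finset.sum_congr rfl fun a _ => h3 a, Matrix.mul_sub,
    Matrix.mul_add, Matrix.sub_mul, Matrix.add_mul, Matrix.mul_sum, Matrix.sum_mul]

theorem generator_diagonal_apply [DecidableEq m] {K : Matrix m m ℂ} {W : ι → Matrix m m ℂ} (z : m → ℝ) (i j : m) :
    generator K W (diagonal fun a => (z a : ℂ)) i j =
      K i j * z j + z i * star (K j i) - ∑ k, ∑ a, W k i a * z a * star (W k j a) := by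
  rw [generator, Matrix.sub_apply, Matrix.add_apply, mul_diagonal, diagonal_mul, Matrix.sum_apply, conjTranspose_apply]
  congr 1
  refine Finset.sum_congr rfl fun k _ => ?_
  rw [mul_apply]
  exact Finset.sum_congr rfl fun a _ => by rw [mul_diagonal, conjTranspose_apply]

/-- On the diagonal, `K` enters only through the diagonal of `K + K*`, whose entries are the total
jump rates out of each index. The skew-Hermitian part of `K`, and with it any Hamiltonian, is
therefore invisible. -/
theorem generator_diagonal_apply_same [DecidableEq m] {K : Matrix m m ℂ} {W : ι → Matrix m m ℂ}
    (hK : K + Kᴴ = ∑ k, (W k)ᴴ * W k) (z : m → ℝ) (i : m) :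
    generator K W (diagonal fun a => (z a : ℂ)) i i =
      ((-∑ j, (jumpRate W i j * z j - jumpRate W j i * z i) : ℝ) : ℂ) := by
  have h := congrFun (congrFun hK i) i
  rw [Matrix.add_apply, conjTranspose_apply, Matrix.sum_apply] at h
  have h' : ∑ k, ((W k)ᴴ * W k) i i = ((∑ j, jumpRate W j i : ℝ) : ℂ) := by
    simp only [jumpRate]
    rw [Finset.sum_comm]
    push_cast
    refine Finset.sum_congr rfl fun k _ => ?_
    rw [mul_apply]
    refine Finset.sum_congr rfl fun a _ => ?_
    rw [conjTranspose_apply, Complex.normSq_eq_conj_mul_self]; rfl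
  have h'' : ∑ k, ∑ a, W k i a * z a * star (W k i a) = ((∑ j, jumpRate W i j * z j : ℝ) : ℂ) := by
    simp only [jumpRate, Finset.sum_mul]
    rw [Finset.sum_comm]
    push_cast
    refine Finset.sum_congr rfl fun a _ => Finset.sum_congr rfl fun k _ => ?_
    rw [← Complex.mul_conj]
    change _ * _ * (starRingEnd ℂ) _ = _
    ring
  rw [generator_diagonal_apply, h'', mul_comm (z i : ℂ), ← add_mul, h, h', Finset.sum_sub_distrib,
    ← Finset.sum_mul]
  push_cast
  ring

end Generator

/-- The operator `K = i H₀ + ½ ∑ₖ Vₖ* Vₖ`. -/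
def effective (H₀ : Matrix (Fin n) (Fin n) ℂ) (V : Fin r → Matrix (Fin n) (Fin n) ℂ) :
    Matrix (Fin n) (Fin n) ℂ :=
  Complex.I • H₀ + (1 / 2 : ℂ) • ∑ k, (V k)ᴴ * V k

theorem effective_add_conjTranspose {H₀ : Matrix (Fin n) (Fin n) ℂ} (hH : H₀.IsHermitian)
    (V : Fin r → Matrix (Fin n) (Fin n) ℂ) :
    effective H₀ V + (effective H₀ V)ᴴ = ∑ k, (V k)ᴴ * V k := by
  have h : (∑ k, (V k)ᴴ * V k)ᴴ = ∑ k, (V k)ᴴ * V k := by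
    rw [conjTranspose_sum]
    exact Finset.sum_congr rfl fun k _ => by rw [conjTranspose_mul, conjTranspose_conjTranspose]
  rw [effective, conjTranspose_add, conjTranspose_smul, conjTranspose_smul, hH.eq, h]
  have h2 : star (1 / 2 : ℂ) = 1 / 2 := by simp
  have h3 : star Complex.I = -Complex.I := by simp
  rw [h2, h3]
  module

theorem lindblad_apply {H₀ : Matrix (Fin n) (Fin n) ℂ} (hH : H₀.IsHermitian)
    (V : Fin r → Matrix (Fin n) (Fin n) ℂ) (ρ : Matrix (Fin n) (Fin n) ℂ) :
    lindblad H₀ V ρ = generator (effective H₀ V) V ρ := by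
  have h : (effective H₀ V)ᴴ = -(Complex.I • H₀) + (1 / 2 : ℂ) • ∑ k, (V k)ᴴ * V k := by
    rw [eq_sub_of_add_eq' (effective_add_conjTranspose hH V), effective]
    module
  rw [generator, h, effective, lindblad, LinearMap.add_apply, LinearMap.sum_apply]
  simp only [iAd, dissipator, LinearMap.coe_mk, AddHom.coe_mk, Finset.sum_sub_distrib, add_mul,
    mul_add, smul_mul_assoc, mul_smul_comm, Finset.sum_mul, Finset.mul_sum, smul_add, smul_sub,
    Finset.sum_add_distrib, mul_neg, Finset.smul_sum]
  abel

theorem iAd_add_lindblad (H₀ H : Matrix (Fin n) (Fin n) ℂ)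
    (V : Fin r → Matrix (Fin n) (Fin n) ℂ) :
    iAd H + lindblad H₀ V = lindblad (H₀ + H) V := by
  ext1 ρ
  simp only [lindblad, ← add_assoc, LinearMap.add_apply]
  congr 1
  simp only [iAd, LinearMap.coe_mk, AddHom.coe_mk, add_mul, mul_add]
  rw [← smul_add]
  congr 1
  abel

/-! ### Change of orthonormal basis -/

/-- The Lindblad terms in the basis of the columns of `U`. -/
def conjTerms (V : Fin r → Matrix (Fin n) (Fin n) ℂ) (U : Matrix (Fin n) (Fin n) ℂ) :
    Fin r → Matrix (Fin n) (Fin n) ℂ := fun k => Uᴴ * V k * U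

theorem conjTranspose_mul_self_of_mem {U : Matrix (Fin n) (Fin n) ℂ}
    (hU : U ∈ unitaryGroup (Fin n) ℂ) : Uᴴ * U = 1 := mem_unitaryGroup_iff'.1 hU

theorem mul_conjTranspose_self_of_mem {U : Matrix (Fin n) (Fin n) ℂ}
    (hU : U ∈ unitaryGroup (Fin n) ℂ) : U * Uᴴ = 1 := mem_unitaryGroup_iff.1 hU

theorem conj_add_conjTranspose {K U : Matrix (Fin n) (Fin n) ℂ}
    {V : Fin r → Matrix (Fin n) (Fin n) ℂ} (hU : U ∈ unitaryGroup (Fin n) ℂ)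
    (hK : K + Kᴴ = ∑ k, (V k)ᴴ * V k) :
    (Uᴴ * K * U) + (Uᴴ * K * U)ᴴ = ∑ k, (conjTerms V U k)ᴴ * conjTerms V U k := by
  have h1 : ∀ k, (conjTerms V U k)ᴴ * conjTerms V U k = Uᴴ * ((V k)ᴴ * V k) * U := fun k => by
    simp only [conjTerms, conjTranspose_mul, conjTranspose_conjTranspose, Matrix.mul_assoc]
    rw [← Matrix.mul_assoc U, mul_conjTranspose_self_of_mem hU, Matrix.one_mul]
  rw [Finset.sum_congr rfl fun k _ => h1 k, ← Matrix.sum_mul, ← Matrix.mul_sum, ← hK]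
  simp only [conjTranspose_mul, conjTranspose_conjTranspose, Matrix.mul_assoc, mul_add, add_mul]

theorem generator_conj {K U : Matrix (Fin n) (Fin n) ℂ}
    {V : Fin r → Matrix (Fin n) (Fin n) ℂ} (hU : U ∈ unitaryGroup (Fin n) ℂ)
    (σ : Matrix (Fin n) (Fin n) ℂ) :
    generator K V (U * σ * Uᴴ) = U * generator (Uᴴ * K * U) (conjTerms V U) σ * Uᴴ := by
  refine generator_isometry (fun a => ?_) ?_ σ <;>
    simp only [conjTerms, ← Matrix.mul_assoc, mul_conjTranspose_self_of_mem hU, Matrix.one_mul]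

/-- The induced vector field is the classical generator with the rates `jumpRate`. -/
theorem inducedField_mulVec {H₀ : Matrix (Fin n) (Fin n) ℂ} (hH : H₀.IsHermitian)
    (V : Fin r → Matrix (Fin n) (Fin n) ℂ) {U : Matrix (Fin n) (Fin n) ℂ}
    (hU : U ∈ unitaryGroup (Fin n) ℂ) (x : Fin n → ℝ) (i : Fin n) :
    (inducedField (lindblad H₀ V) U *ᵥ x) i =
      ∑ j, (jumpRate (conjTerms V U) i j * x j - jumpRate (conjTerms V U) j i * x i) := by
  rw [inducedField, LinearMap.toMatrix'_mulVec]
  change -((Uᴴ * lindblad H₀ V (U * diagonal (fun j => (x j : ℂ)) * Uᴴ) * U) i i).re = _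
  have h : ∀ A : Matrix (Fin n) (Fin n) ℂ, Uᴴ * (U * A * Uᴴ) * U = A := fun A => by
    rw [Matrix.mul_assoc, Matrix.mul_assoc, conjTranspose_mul_self_of_mem hU, Matrix.mul_one,
      ← Matrix.mul_assoc, conjTranspose_mul_self_of_mem hU, Matrix.one_mul]
  rw [lindblad_apply hH, generator_conj hU, h, generator_diagonal_apply_same
    (conj_add_conjTranspose hU (effective_add_conjTranspose hH V)), Complex.ofReal_re, neg_neg]

/-! ### Hermitian fixed points of irreducible generators -/

section FixedPoints

variable {m ι : Type*} [Fintype m] [Fintype ι]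

/-- For an equilibrium of a classical generator there is no jump out of the negative part. -/
theorem rate_eq_zero_of_equilibrium {J : m → m → ℝ} (hJ : ∀ i j, 0 ≤ J i j) {z : m → ℝ}
    (hz : ∀ i, ∑ j, (J i j * z j - J j i * z i) = 0) {i j : m} (hi : z i < 0) (hj : 0 ≤ z j) :
    J j i = 0 := by
  classical
  set a : m → m → ℝ := fun i j => J i j * z j - J j i * z i with ha
  set N : Finset m := Finset.univ.filter fun i => z i < 0 with hN
  -- The net flow `a i j` from `j` to `i` is antisymmetric, so flows inside `N` cancel and
  -- equilibrium forces the total flow from `Nᶜ` into `N` to vanish.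
  have h1 : ∑ i ∈ N, ∑ j ∈ N, a i j = 0 := by
    have h : ∑ i ∈ N, ∑ j ∈ N, a i j = -∑ i ∈ N, ∑ j ∈ N, a i j := by
      conv_lhs => rw [Finset.sum_comm]
      rw [← Finset.sum_neg_distrib]
      refine Finset.sum_congr rfl fun i _ => ?_
      rw [← Finset.sum_neg_distrib]
      exact Finset.sum_congr rfl fun j _ => by simp only [ha]; ring
    linarith
  have h2 : ∑ i ∈ N, ∑ j ∈ Nᶜ, a i j = 0 := by
    have h : ∑ i ∈ N, (∑ j ∈ N, a i j + ∑ j ∈ Nᶜ, a i j) = 0 :=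
      Finset.sum_eq_zero fun i _ => by rw [Finset.sum_add_sum_compl]; exact hz i
    rw [Finset.sum_add_distrib, h1, zero_add] at h
    exact h
  -- Nonnegative mass flowing into `N` and negative mass flowing out of it both contribute with the
  -- same sign, so each contribution is zero.
  have hnn : ∀ i ∈ N, ∀ j ∈ Nᶜ, 0 ≤ a i j := fun i hi j hj => by
    have h3 : z i < 0 := by simpa [hN] using hi
    have h4 : 0 ≤ z j := by simpa [hN] using hj
    have := mul_nonneg (hJ i j) h4
    have := mul_nonneg (hJ j i) (neg_nonneg.2 h3.le)
    simp only [ha]; linarith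
  have hiN : i ∈ N := by simpa [hN] using hi
  have hjN : j ∈ Nᶜ := by simpa [hN] using hj
  have h3 := (Finset.sum_eq_zero_iff_of_nonneg fun i hi => Finset.sum_nonneg (hnn i hi)).1 h2 i hiN
  have h4 := (Finset.sum_eq_zero_iff_of_nonneg (hnn i hiN)).1 h3 j hjN
  have h5 := mul_nonneg (hJ i j) hj
  have h6 := hJ j i
  simp only [ha] at h4
  by_contra h
  have h7 : 0 < J j i := lt_of_le_of_ne h6 (Ne.symm h)
  nlinarith [mul_pos h7 (neg_pos.2 hi)]

variable [DecidableEq m]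

theorem term_eq_zero_of_fixed {K : Matrix m m ℂ} {W : ι → Matrix m m ℂ}
    (hK : K + Kᴴ = ∑ k, (W k)ᴴ * W k) {z : m → ℝ}
    (hz : generator K W (diagonal fun a => (z a : ℂ)) = 0) {i j : m} (hi : z i < 0)
    (hj : 0 ≤ z j) (k : ι) : W k j i = 0 := by
  refine jumpRate_eq_zero_iff.1
    (rate_eq_zero_of_equilibrium (jumpRate_nonneg W) (z := z) (fun i => ?_) hi hj) k
  have h := generator_diagonal_apply_same hK z i
  rw [hz, Matrix.zero_apply] at h
  have h' : (0 : ℝ) = -∑ j, (jumpRate W i j * z j - jumpRate W j i * z i) := by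
    exact_mod_cast h
  linarith

theorem term_eq_zero_of_fixed' {K : Matrix m m ℂ} {W : ι → Matrix m m ℂ}
    (hK : K + Kᴴ = ∑ k, (W k)ᴴ * W k) {z : m → ℝ}
    (hz : generator K W (diagonal fun a => (z a : ℂ)) = 0) {i j : m} (hi : 0 < z i)
    (hj : z j ≤ 0) (k : ι) : W k j i = 0 := by
  refine term_eq_zero_of_fixed hK (z := fun a => -z a) ?_ (neg_neg_iff_pos.2 hi)
    (neg_nonneg.2 hj) k
  have h : (diagonal fun a => ((-z a : ℝ) : ℂ)) = (-1 : ℂ) • diagonal fun a => (z a : ℂ) := by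
    rw [← diagonal_smul]
    congr 1
    funext a
    simp
  rw [h, generator_smul, hz, smul_zero]

/-- In the entry `(j, i)` of the fixed-point equation every jump term dies, since no jump leads out
of the negative or out of the positive part. If `z j > 0`, the same reasoning kills the entry `(j,
i)` of `K + K*`. The two resulting relations combine to `K j i * (z i - z j) = 0`, and `z i < 0 < z
j`. -/
theorem effective_eq_zero_of_fixed {K : Matrix m m ℂ} {W : ι → Matrix m m ℂ}
    (hK : K + Kᴴ = ∑ k, (W k)ᴴ * W k) {z : m → ℝ}
    (hz : generator K W (diagonal fun a => (z a : ℂ)) = 0) {i j : m} (hi : z i < 0)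
    (hj : 0 ≤ z j) : K j i = 0 := by
  have h1 : K j i * z i + z j * star (K i j) = 0 := by
    have h := generator_diagonal_apply (K := K) (W := W) z j i
    rw [hz, Finset.sum_eq_zero, sub_zero] at h
    · exact h.symm
    refine fun k _ => Finset.sum_eq_zero fun a _ => ?_
    rcases lt_trichotomy (z a) 0 with ha | ha | ha
    · rw [term_eq_zero_of_fixed hK hz ha hj k]; simp
    · rw [ha]; simp
    · rw [term_eq_zero_of_fixed' hK hz ha hi.le k]; simp
  have hi' : (z i : ℂ) ≠ 0 := by exact_mod_cast hi.ne
  rcases hj.eq_or_lt with hj0 | hj0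
  · rw [← hj0] at h1
    simpa [hi'] using h1
  have h2 : K j i + star (K i j) = 0 := by
    have h := congrFun (congrFun hK j) i
    rw [Matrix.add_apply, conjTranspose_apply, Matrix.sum_apply] at h
    rw [h]
    refine Finset.sum_eq_zero fun k _ => ?_
    rw [mul_apply]
    refine Finset.sum_eq_zero fun a _ => ?_
    rcases lt_or_ge (z a) 0 with ha | ha
    · rw [conjTranspose_apply, term_eq_zero_of_fixed' hK hz hj0 ha.le k]; simp
    · rw [term_eq_zero_of_fixed hK hz hi ha k]; simp
  have h3 : K j i * ((z i : ℂ) - z j) = 0 := by linear_combination h1 - (z j : ℂ) * h2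
  refine (mul_eq_zero.1 h3).resolve_right ?_
  rw [sub_eq_zero]
  exact_mod_cast (hi.trans_le hj).ne

end FixedPoints

/-- The matrices mapping the span of the basis vectors in `N` into itself. -/
def blockSubalgebra (R : Type*) [CommSemiring R] {m : Type*} [Fintype m] [DecidableEq m]
    (N : Set m) : Subalgebra R (Matrix m m R) where
  carrier := {M | ∀ i ∈ N, ∀ j ∉ N, M j i = 0}
  mul_mem' {A B} hA hB i hi j hj := by
    rw [mul_apply]
    refine Finset.sum_eq_zero fun a _ => ?_
    by_cases ha : a ∈ N
    · rw [hA a ha j hj, zero_mul]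
    · rw [hB i hi a ha, mul_zero]
  add_mem' {A B} hA hB i hi j hj := by
    rw [Matrix.add_apply, hA i hi j hj, hB i hi j hj, add_zero]
  algebraMap_mem' c i hi j hj := by
    rw [algebraMap_matrix_apply, if_neg]
    rintro rfl
    exact hj hi

/-- Conjugation `M ↦ U* M U` by a unitary matrix. -/
def unitaryConj {U : Matrix (Fin n) (Fin n) ℂ} (hU : U ∈ unitaryGroup (Fin n) ℂ) :
    Matrix (Fin n) (Fin n) ℂ →ₐ[ℂ] Matrix (Fin n) (Fin n) ℂ :=
  AlgHom.ofLinearMap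
    { toFun := fun M => Uᴴ * M * U
      map_add' := fun A B => by rw [Matrix.mul_add, Matrix.add_mul]
      map_smul' := fun c A => by simp }
    (by
      change Uᴴ * 1 * U = 1
      rw [Matrix.mul_one, conjTranspose_mul_self_of_mem hU])
    (fun A B => by
      change Uᴴ * (A * B) * U = Uᴴ * A * U * (Uᴴ * B * U)
      have h : U * (Uᴴ * (B * U)) = B * U := by
        rw [← Matrix.mul_assoc, mul_conjTranspose_self_of_mem hU, Matrix.one_mul]
      simp only [Matrix.mul_assoc, h])

/-- The signs of the eigenvalues of a Hermitian fixed point of an irreducible generator agree. -/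
theorem eigenvalues_neg_of_fixed {K : Matrix (Fin n) (Fin n) ℂ}
    {V : Fin r → Matrix (Fin n) (Fin n) ℂ} (hK : K + Kᴴ = ∑ k, (V k)ᴴ * V k)
    (htop : Algebra.adjoin ℂ (insert K (Set.range V)) = ⊤) {U : Matrix (Fin n) (Fin n) ℂ}
    (hU : U ∈ unitaryGroup (Fin n) ℂ) {z : Fin n → ℝ}
    (hz : generator K V (U * diagonal (fun a => (z a : ℂ)) * Uᴴ) = 0) {i : Fin n} (hi : z i < 0)
    (j : Fin n) : z j < 0 := by
  by_contra! hj
  have hz' : generator (Uᴴ * K * U) (conjTerms V U) (diagonal fun a => (z a : ℂ)) = 0 := by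
    rw [generator_conj hU] at hz
    have h : Uᴴ * (U * generator (Uᴴ * K * U) (conjTerms V U) (diagonal fun a => (z a : ℂ)) * Uᴴ)
        * U = 0 := by rw [hz]; simp
    rwa [Matrix.mul_assoc, Matrix.mul_assoc, conjTranspose_mul_self_of_mem hU, Matrix.mul_one,
      ← Matrix.mul_assoc, conjTranspose_mul_self_of_mem hU, Matrix.one_mul] at h
  have hK' := conj_add_conjTranspose hU hK
  have hle : Algebra.adjoin ℂ (insert K (Set.range V)) ≤
      (blockSubalgebra ℂ {a | z a < 0}).comap (unitaryConj hU) := by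
    rw [Algebra.adjoin_le_iff]
    rintro M (rfl | ⟨k, rfl⟩) a ha b hb
    · exact effective_eq_zero_of_fixed hK' hz' ha (not_lt.1 hb)
    · exact term_eq_zero_of_fixed hK' hz' ha (not_lt.1 hb) k
  rw [htop] at hle
  -- The full algebra contains the matrix unit that sends the eigenvector `i` to the eigenvector
  -- `j`, and this does not preserve the negative block.
  have h := hle (Algebra.mem_top : U * single j i 1 * Uᴴ ∈ ⊤) i hi j (not_lt.2 hj)
  change (Uᴴ * (U * single j i 1 * Uᴴ) * U : Matrix (Fin n) (Fin n) ℂ) j i = 0 at h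
  rw [Matrix.mul_assoc, Matrix.mul_assoc, conjTranspose_mul_self_of_mem hU, Matrix.mul_one,
    ← Matrix.mul_assoc, conjTranspose_mul_self_of_mem hU, Matrix.one_mul] at h
  simp at h

/-- The spectral decomposition of a Hermitian matrix. -/
theorem exists_unitary_diagonal {Z : Matrix (Fin n) (Fin n) ℂ} (hZ : Z.IsHermitian) :
    ∃ U ∈ unitaryGroup (Fin n) ℂ, Z = U * diagonal (fun a => (hZ.eigenvalues a : ℂ)) * Uᴴ :=
  ⟨hZ.eigenvectorUnitary, hZ.eigenvectorUnitary.2, by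
    conv_lhs => rw [hZ.spectral_theorem]
    rfl⟩

/-- One negative eigenvalue makes all of them negative; applied to `-Z`, one positive eigenvalue
makes all of them positive. -/
theorem definite_of_fixed {K : Matrix (Fin n) (Fin n) ℂ}
    {V : Fin r → Matrix (Fin n) (Fin n) ℂ} (hK : K + Kᴴ = ∑ k, (V k)ᴴ * V k)
    (htop : Algebra.adjoin ℂ (insert K (Set.range V)) = ⊤) {Z : Matrix (Fin n) (Fin n) ℂ}
    (hZ : Z.IsHermitian) (hfix : generator K V Z = 0) :
    Z = 0 ∨ Z.PosDef ∨ (-Z).PosDef := by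
  obtain ⟨U, hU, hUZ⟩ := exists_unitary_diagonal hZ
  have hfix' := hfix
  rw [hUZ] at hfix'
  have hneg : -Z = U * diagonal (fun a => ((-hZ.eigenvalues a : ℝ) : ℂ)) * Uᴴ := by
    conv_lhs => rw [hUZ]
    rw [← Matrix.neg_mul, ← Matrix.mul_neg, diagonal_neg]
    congr 3
    funext a
    simp
  have hpd : ∀ z : Fin n → ℝ, (∀ a, 0 < z a) →
      (U * diagonal (fun a => (z a : ℂ)) * Uᴴ).PosDef := fun z hz =>
    (PosDef.diagonal fun a => by exact_mod_cast hz a).mul_mul_conjTranspose_same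
      (Function.LeftInverse.injective (g := fun v => v ᵥ* Uᴴ) fun v => by
        simp [vecMul_vecMul, mul_conjTranspose_self_of_mem hU])
  by_cases h1 : ∃ i, hZ.eigenvalues i < 0
  · obtain ⟨i, hi⟩ := h1
    refine Or.inr (Or.inr ?_)
    rw [hneg]
    exact hpd _ fun a => neg_pos.2 (eigenvalues_neg_of_fixed hK htop hU hfix' hi a)
  by_cases h2 : ∃ i, 0 < hZ.eigenvalues i
  · obtain ⟨i, hi⟩ := h2
    refine Or.inr (Or.inl ?_)
    rw [hUZ]
    refine hpd _ fun a => neg_neg_iff_pos.1 (eigenvalues_neg_of_fixed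
      (z := fun a => -hZ.eigenvalues a) hK htop hU ?_ (neg_neg_iff_pos.2 hi) a)
    rw [← hneg, ← neg_one_smul ℂ Z, generator_smul, hfix, smul_zero]
  · push Not at h1 h2
    refine Or.inl ?_
    have h : (fun a => (hZ.eigenvalues a : ℂ)) = 0 := by
      funext a
      rw [le_antisymm (h2 a) (h1 a), Complex.ofReal_zero, Pi.zero_apply]
    rw [hUZ, h]
    simp

/-- An irreducible generator has a unique fixed state, and this state is faithful. -/
theorem exists_unique_fixed {K : Matrix (Fin n) (Fin n) ℂ}
    {V : Fin r → Matrix (Fin n) (Fin n) ℂ} (hn : n ≠ 0) (hK : K + Kᴴ = ∑ k, (V k)ᴴ * V k)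
    (htop : Algebra.adjoin ℂ (insert K (Set.range V)) = ⊤) :
    ∃ ρ : Matrix (Fin n) (Fin n) ℂ, ρ.PosDef ∧ ρ.trace = 1 ∧ generator K V ρ = 0 ∧
      ∀ σ, IsState σ → generator K V σ = 0 → σ = ρ := by
  have : NeZero n := ⟨hn⟩
  -- The image consists of traceless matrices, so it misses the identity; in finite dimension the
  -- kernel is then nontrivial.
  have hinj : ∃ Z, Z ≠ 0 ∧ generator K V Z = 0 := by
    by_contra! h
    have hi : Function.Injective (generatorLin K V) := by
      rw [← LinearMap.ker_eq_bot, LinearMap.ker_eq_bot']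
      intro Z hZ
      by_contra h0
      exact h Z h0 hZ
    obtain ⟨Z, hZ⟩ := (LinearMap.injective_iff_surjective.1 hi) 1
    have h1 := trace_generator hK Z
    change (generatorLin K V Z).trace = 0 at h1
    rw [hZ, trace_one, Fintype.card_fin] at h1
    exact hn (by exact_mod_cast h1)
  obtain ⟨Z, hZ0, hZ⟩ := hinj
  -- The kernel is closed under adjoints. If `Z + Z*` vanishes, `Z` is skew-Hermitian and `i Z`
  -- serves instead.
  have hherm : ∃ Y : Matrix (Fin n) (Fin n) ℂ, Y.IsHermitian ∧ Y ≠ 0 ∧ generator K V Y = 0 := by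
    have hZ' : generator K V Zᴴ = 0 := by rw [generator_conjTranspose, hZ, conjTranspose_zero]
    by_cases h : Z + Zᴴ = 0
    · refine ⟨Complex.I • Z, ?_, smul_ne_zero Complex.I_ne_zero hZ0, ?_⟩
      · rw [IsHermitian, conjTranspose_smul, eq_neg_of_add_eq_zero_right h]
        simp
      · rw [generator_smul, hZ, smul_zero]
    · exact ⟨Z + Zᴴ, by rw [IsHermitian, conjTranspose_add, conjTranspose_conjTranspose, add_comm],
        h, by rw [generator_add, hZ, hZ', add_zero]⟩
  obtain ⟨Y, hY, hY0, hYfix⟩ := hherm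
  have hpos : ∃ P : Matrix (Fin n) (Fin n) ℂ, P.PosDef ∧ generator K V P = 0 := by
    rcases definite_of_fixed hK htop hY hYfix with h | h | h
    · exact absurd h hY0
    · exact ⟨Y, h, hYfix⟩
    · exact ⟨-Y, h, by rw [← neg_one_smul ℂ Y, generator_smul, hYfix, smul_zero]⟩
  obtain ⟨P, hP, hPfix⟩ := hpos
  have htr : 0 < P.trace := hP.trace_pos
  have hinv : 0 < (P.trace)⁻¹ := by
    rw [RCLike.inv_pos]
    exact htr
  refine ⟨(P.trace)⁻¹ • P, hP.smul hinv, ?_, ?_, ?_⟩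
  · rw [trace_smul, smul_eq_mul, inv_mul_cancel₀ htr.ne']
  · rw [generator_smul, hPfix, smul_zero]
  intro σ hσ hσfix
  -- The difference of two fixed states is a traceless Hermitian fixed point, hence neither positive
  -- nor negative definite, hence zero.
  have hfix : generator K V (σ - (P.trace)⁻¹ • P) = 0 := by
    rw [sub_eq_add_neg, ← neg_smul, generator_add, generator_smul, hσfix, hPfix, smul_zero,
      add_zero]
  have htr0 : (σ - (P.trace)⁻¹ • P).trace = 0 := by
    rw [trace_sub, hσ.2, trace_smul, smul_eq_mul, inv_mul_cancel₀ htr.ne', sub_self]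
  rcases definite_of_fixed hK htop (hσ.1.isHermitian.sub (hP.smul hinv).isHermitian) hfix with
    h | h | h
  · exact sub_eq_zero.1 h
  · exact absurd htr0 h.trace_pos.ne'
  · have := h.trace_pos
    rw [trace_neg, htr0, neg_zero] at this
    exact absurd this (lt_irrefl _)

/-! ### Irreducibility by a suitable choice of Hamiltonian -/

theorem subalgebra_eq_top_of_single_mem {m : Type*} [Fintype m] [DecidableEq m]
    {A : Subalgebra ℂ (Matrix m m ℂ)} (h : ∀ i j, single i j 1 ∈ A) : A = ⊤ := by
  refine eq_top_iff.2 fun M _ => ?_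
  rw [matrix_eq_sum_single M]
  refine sum_mem fun i _ => sum_mem fun j _ => ?_
  have := A.smul_mem (h i j) (M i j)
  rwa [smul_single, smul_eq_mul, mul_one] at this

/-- The nilpotent shift. -/
def shiftMatrix (m : ℕ) : Matrix (Fin (m + 1)) (Fin (m + 1)) ℂ :=
  of fun i j => if (i : ℕ) + 1 = j then 1 else 0

theorem shiftMatrix_pow_apply (m a : ℕ) (i j : Fin (m + 1)) :
    (shiftMatrix m ^ a) i j = if (i : ℕ) + a = j then 1 else 0 := by
  induction a generalizing j with
  | zero => simp [one_apply, Fin.ext_iff]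
  | succ a ih =>
    rw [pow_succ, mul_apply]
    by_cases h : (i : ℕ) + (a + 1) = j
    · rw [if_pos h, Finset.sum_eq_single (⟨i + a, by omega⟩ : Fin (m + 1))]
      · rw [ih, if_pos rfl, one_mul, shiftMatrix, of_apply, if_pos (by simpa [add_assoc] using h)]
      · intro b _ hb
        rw [ih, if_neg, zero_mul]
        exact fun h' => hb (Fin.ext h'.symm)
      · simp
    · rw [if_neg h]
      refine Finset.sum_eq_zero fun b _ => ?_
      rw [ih, shiftMatrix, of_apply]
      split_ifs
      · omega
      all_goals simp

theorem shiftMatrix_pow_last (m : ℕ) : shiftMatrix m ^ m = single 0 (Fin.last m) 1 := by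
  ext i j
  rw [shiftMatrix_pow_apply, single_apply]
  refine if_congr ?_ rfl rfl
  rw [Fin.ext_iff, Fin.ext_iff, Fin.val_last, Fin.val_zero]
  omega

theorem mul_single_eq_sum {m : Type*} [Fintype m] [DecidableEq m] (M : Matrix m m ℂ) (a b : m) :
    M * single a b 1 = ∑ i, M i a • single i b 1 := by
  ext i j
  simp [Matrix.sum_apply, mul_apply, single_apply, ite_and, Finset.sum_ite_eq]

theorem single_mul_eq_sum {m : Type*} [Fintype m] [DecidableEq m] (M : Matrix m m ℂ) (a b : m) :
    single a b 1 * M = ∑ j, M b j • single a j 1 := by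
  ext i j
  simp [Matrix.sum_apply, mul_apply, single_apply, ite_and, Finset.sum_ite_eq]

/-- The top power of the shift `N` is the unit `e₀ₘ`. In the last column of `N^(m-c) B e₀ₘ`, the
entry in row `c` is the corner `B m 0` and all entries below it vanish; induction on `c` yields
every unit in the last column. Symmetrically, `e₀ₘ B N^i` yields every unit in row `0`. Sandwiching
`B` between a column unit and a row unit then gives a nonzero multiple of an arbitrary unit. -/
theorem eq_top_of_shiftMatrix_mem {m : ℕ} {A : Subalgebra ℂ (Matrix (Fin (m + 1)) (Fin (m + 1)) ℂ)}
    {B : Matrix (Fin (m + 1)) (Fin (m + 1)) ℂ} (hN : shiftMatrix m ∈ A) (hB : B ∈ A)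
    (hb : B (Fin.last m) 0 ≠ 0) : A = ⊤ := by
  have hE : single 0 (Fin.last m) 1 ∈ A := shiftMatrix_pow_last m ▸ A.pow_mem hN m
  have hcancel : ∀ (c : ℂ) (M : Matrix (Fin (m + 1)) (Fin (m + 1)) ℂ), c ≠ 0 → c • M ∈ A → M ∈ A :=
    fun c M hc h => by simpa [smul_smul, inv_mul_cancel₀ hc] using A.smul_mem h c⁻¹
  have hcol : ∀ c : ℕ, ∀ i : Fin (m + 1), (i : ℕ) = c → single i (Fin.last m) 1 ∈ A := by
    intro c
    induction c using Nat.strong_induction_on with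
    | _ c ih =>
      intro i hi
      have hT : shiftMatrix m ^ (m - c) * B * single 0 (Fin.last m) 1 ∈ A :=
        A.mul_mem (A.mul_mem (A.pow_mem hN _) hB) hE
      rw [mul_single_eq_sum, ← Finset.add_sum_erase _ _ (Finset.mem_univ i)] at hT
      have hi' : (shiftMatrix m ^ (m - c) * B) i 0 = B (Fin.last m) 0 := by
        rw [mul_apply, Finset.sum_eq_single (Fin.last m)]
        · rw [shiftMatrix_pow_apply, if_pos (by rw [Fin.val_last]; omega), one_mul]
        · intro b _ hb
          rw [shiftMatrix_pow_apply, if_neg, zero_mul]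
          exact fun h => hb (Fin.ext (by rw [Fin.val_last]; omega))
        · simp
      rw [hi'] at hT
      refine hcancel _ _ hb ((add_mem_cancel_right (sum_mem fun j hj => ?_)).1 hT)
      rcases lt_or_gt_of_ne (Fin.val_ne_of_ne (Finset.ne_of_mem_erase hj)) with h | h
      · exact A.smul_mem (ih j (hi ▸ h) j rfl) _
      · rw [mul_apply, Finset.sum_eq_zero, zero_smul]
        · exact A.zero_mem
        · intro b _
          rw [shiftMatrix_pow_apply, if_neg (by omega), zero_mul]
  have hrow : ∀ c : ℕ, ∀ i : Fin (m + 1), (i : ℕ) + c = m → single 0 i 1 ∈ A := by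
    intro c
    induction c using Nat.strong_induction_on with
    | _ c ih =>
      intro i hi
      have hT : single 0 (Fin.last m) 1 * (B * shiftMatrix m ^ (i : ℕ)) ∈ A :=
        A.mul_mem hE (A.mul_mem hB (A.pow_mem hN _))
      rw [single_mul_eq_sum, ← Finset.add_sum_erase _ _ (Finset.mem_univ i)] at hT
      have hi' : (B * shiftMatrix m ^ (i : ℕ)) (Fin.last m) i = B (Fin.last m) 0 := by
        rw [mul_apply, Finset.sum_eq_single 0]
        · rw [shiftMatrix_pow_apply, if_pos (by simp), mul_one]
        · intro b _ hb
          rw [shiftMatrix_pow_apply, if_neg, mul_zero]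
          exact fun h => hb (Fin.ext (by rw [Fin.val_zero]; omega))
        · simp
      rw [hi'] at hT
      refine hcancel _ _ hb ((add_mem_cancel_right (sum_mem fun j hj => ?_)).1 hT)
      rcases lt_or_gt_of_ne (Fin.val_ne_of_ne (Finset.ne_of_mem_erase hj)) with h | h
      · rw [mul_apply, Finset.sum_eq_zero, zero_smul]
        · exact A.zero_mem
        · intro b _
          rw [shiftMatrix_pow_apply, if_neg (by omega), mul_zero]
      · exact A.smul_mem (ih (m - j) (by omega) j (by omega)) _
  refine subalgebra_eq_top_of_single_mem fun i j => hcancel _ _ hb ?_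
  have h := A.mul_mem (A.mul_mem (hcol _ i rfl) hB) (hrow (m - j) j (by omega))
  rwa [single_mul_mul_single, one_mul, mul_one, ← mul_one (B _ _), ← smul_eq_mul,
    ← smul_single] at h

/-- Used to relabel the basis so that a nonzero off-diagonal entry moves to the bottom left corner.
-/
theorem exists_perm_apply_eq {m : ℕ} {i j : Fin (m + 1)} (h : i ≠ j) :
    ∃ p : Equiv.Perm (Fin (m + 1)), p 0 = j ∧ p (Fin.last m) = i := by
  have hm : (Fin.last m) ≠ 0 := by
    intro h0
    have : m = 0 := by simpa [Fin.ext_iff] using h0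
    subst this
    exact h (Fin.ext (by omega))
  refine ⟨(Equiv.swap 0 j).trans (Equiv.swap (Equiv.swap 0 j (Fin.last m)) i), ?_, ?_⟩
  · rw [Equiv.trans_apply, Equiv.swap_apply_left]
    refine Equiv.swap_apply_of_ne_of_ne (fun h' => hm ?_) h.symm
    apply (Equiv.swap 0 j).injective
    rw [Equiv.swap_apply_left]
    exact h'.symm
  · rw [Equiv.trans_apply, Equiv.swap_apply_left]

/-- A matrix with a nonzero off-diagonal entry generates, together with a suitable matrix, the
full matrix algebra. -/
theorem exists_adjoin_eq_top (B : Fin r → Matrix (Fin n) (Fin n) ℂ) {k : Fin r} {i j : Fin n}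
    (hij : i ≠ j) (hB : B k i j ≠ 0) : ∃ M, Algebra.adjoin ℂ (insert M (Set.range B)) = ⊤ := by
  obtain _ | m := n
  · exact i.elim0
  obtain ⟨p, hp0, hpl⟩ := exists_perm_apply_eq hij
  let f := reindexAlgEquiv ℂ ℂ p
  refine ⟨f (shiftMatrix m), ?_⟩
  set A := Algebra.adjoin ℂ (insert (f (shiftMatrix m)) (Set.range B)) with hA
  have h : A.comap f.toAlgHom = ⊤ := by
    refine eq_top_of_shiftMatrix_mem (B := f.symm (B k)) ?_ ?_ ?_
    · exact Algebra.subset_adjoin (Set.mem_insert _ _)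
    · change f (f.symm (B k)) ∈ A
      rw [AlgEquiv.apply_symm_apply]
      exact Algebra.subset_adjoin (Set.mem_insert_of_mem _ ⟨k, rfl⟩)
    · change B k (p (Fin.last m)) (p 0) ≠ 0
      rwa [hp0, hpl]
  refine eq_top_iff.2 fun M _ => ?_
  have hM : f.symm M ∈ A.comap f.toAlgHom :=
    h ▸ Algebra.mem_top
  have hM' : f (f.symm M) ∈ A := hM
  rwa [AlgEquiv.apply_symm_apply] at hM'

/-- Generating the full matrix algebra is a generic property along complex lines. -/
theorem exists_real_adjoin_eq_top (B : Fin r → Matrix (Fin n) (Fin n) ℂ)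
    (K₀ K₁ : Matrix (Fin n) (Fin n) ℂ) {s₀ : ℂ}
    (h : Algebra.adjoin ℂ (insert (K₀ + s₀ • K₁) (Set.range B)) = ⊤) :
    ∃ s : ℝ, Algebra.adjoin ℂ (insert (K₀ + (s : ℂ) • K₁) (Set.range B)) = ⊤ := by
  let g : ℂ → Option (Fin r) → Matrix (Fin n) (Fin n) ℂ := fun s o => o.elim (K₀ + s • K₁) B
  have hg : ∀ s, Set.range (g s) = insert (K₀ + s • K₁) (Set.range B) := fun s => by
    ext M
    simp [g, Option.exists, eq_comm]
  let φ : ℂ → FreeAlgebra ℂ (Option (Fin r)) →ₐ[ℂ] Matrix (Fin n) (Fin n) ℂ :=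
    fun s => FreeAlgebra.lift ℂ (g s)
  have hφ : ∀ s, (φ s).range = Algebra.adjoin ℂ (insert (K₀ + s • K₁) (Set.range B)) := fun s => by
    rw [← hg, Algebra.adjoin_range_eq_range_freeAlgebra_lift]
  let G' : Option (Fin r) → Matrix (Fin n) (Fin n) (Polynomial ℂ) := fun o =>
    o.elim (K₀.map Polynomial.C + (Polynomial.X : Polynomial ℂ) • K₁.map Polynomial.C)
      fun k => (B k).map Polynomial.C
  let Φ : FreeAlgebra ℂ (Option (Fin r)) →ₐ[ℂ] Matrix (Fin n) (Fin n) (Polynomial ℂ) :=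
    FreeAlgebra.lift ℂ G'
  have hΦ : ∀ s, ((Polynomial.aeval s).mapMatrix : _ →ₐ[ℂ] Matrix (Fin n) (Fin n) ℂ).comp Φ
      = φ s := fun s => by
    refine FreeAlgebra.hom_ext (funext fun o => ?_)
    cases o
    · ext i j
      simp [Φ, φ, G', g]
      ring
    · ext i j
      simp [Φ, φ, G', g]
  have hw : ∀ p : Fin n × Fin n, ∃ w, φ s₀ w = single p.1 p.2 1 := fun p => by
    have : single p.1 p.2 1 ∈ (φ s₀).range := by rw [hφ, h]; exact Algebra.mem_top
    exact this
  choose w hw using hw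
  -- The words `w p` evaluate to the matrix units at `s₀`. The matrix of their entries has a
  -- determinant that is polynomial in `s` and equals `1` at `s₀`. Wherever it does not vanish, the
  -- evaluated words still span all matrices.
  let G : Matrix (Fin n × Fin n) (Fin n × Fin n) (Polynomial ℂ) := of fun p q => Φ (w p) q.1 q.2
  have hG : ∀ s p q, Polynomial.eval s (G p q) = φ s (w p) q.1 q.2 := fun s p q => by
    rw [← hΦ]
    simp [G, Polynomial.coe_aeval_eq_eval]
  have hGdet : ∀ s, Polynomial.eval s G.det = (of fun p q => φ s (w p) q.1 q.2 :
      Matrix (Fin n × Fin n) (Fin n × Fin n) ℂ).det := fun s => by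
    rw [← Polynomial.coe_evalRingHom, RingHom.map_det]
    congr 1
    ext p q
    exact hG s p q
  have hG0 : G.det ≠ 0 := by
    intro h0
    have h1 := hGdet s₀
    have h2 : (of fun p q => φ s₀ (w p) q.1 q.2 :
        Matrix (Fin n × Fin n) (Fin n × Fin n) ℂ) = 1 := by
      ext p q
      rw [of_apply, hw, single_apply, one_apply]
      exact if_congr Prod.ext_iff.symm rfl rfl
    rw [h0, h2, det_one, Polynomial.eval_zero] at h1
    exact zero_ne_one h1
  have hs : ∃ s : ℝ, Polynomial.eval (s : ℂ) G.det ≠ 0 := by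
    by_contra! hall
    refine hG0 (Polynomial.eq_zero_of_infinite_isRoot _ ?_)
    exact (Set.infinite_range_of_injective Complex.ofReal_injective).mono
      (by rintro _ ⟨s, rfl⟩; exact hall s)
  obtain ⟨s, hs⟩ := hs
  refine ⟨s, ?_⟩
  rw [hGdet] at hs
  set D : Matrix (Fin n × Fin n) (Fin n × Fin n) ℂ := of fun p q => φ s (w p) q.1 q.2 with hD
  have hinv : D⁻¹ * D = 1 := nonsing_inv_mul D (isUnit_iff_ne_zero.2 hs)
  rw [← hφ]
  refine subalgebra_eq_top_of_single_mem fun i j => ?_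
  have hsum : single i j 1 = ∑ p, D⁻¹ (i, j) p • φ s (w p) := by
    ext a b
    have h1 := congrFun (congrFun hinv (i, j)) (a, b)
    rw [mul_apply, one_apply] at h1
    rw [Matrix.sum_apply, single_apply]
    exact (if_congr Prod.ext_iff.symm rfl rfl).trans h1.symm
  rw [hsum]
  exact sum_mem fun p _ => Subalgebra.smul_mem _ (AlgHom.mem_range_self _ (w p)) _

/-- Write `M = A + X + i Y` with `X`, `Y` Hermitian and `A` the dissipative part of `K`. On the
complex line `A + i (Y + s X)` the value `s = -i` gives `M`, while real `s` gives an admissible `K`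
with Hamiltonian `Y + s X`; genericity moves from the former to the latter. -/
theorem exists_hermitian_adjoin_eq_top (B : Fin r → Matrix (Fin n) (Fin n) ℂ) {k : Fin r}
    {i j : Fin n} (hij : i ≠ j) (hB : B k i j ≠ 0) :
    ∃ h : Matrix (Fin n) (Fin n) ℂ, h.IsHermitian ∧
      Algebra.adjoin ℂ (insert (effective h B) (Set.range B)) = ⊤ := by
  obtain ⟨M, hM⟩ := exists_adjoin_eq_top B hij hB
  set A : Matrix (Fin n) (Fin n) ℂ := (1 / 2 : ℂ) • ∑ k, (B k)ᴴ * B k with hA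
  set X : Matrix (Fin n) (Fin n) ℂ := (1 / 2 : ℂ) • ((M - A) + (M - A)ᴴ) with hX
  set Y : Matrix (Fin n) (Fin n) ℂ := (-Complex.I / 2 : ℂ) • ((M - A) - (M - A)ᴴ) with hY
  have hXh : X.IsHermitian := by
    rw [IsHermitian, hX, conjTranspose_smul, conjTranspose_add, conjTranspose_conjTranspose,
      add_comm]
    simp
  have hYh : Y.IsHermitian := by
    rw [IsHermitian, hY, conjTranspose_smul, conjTranspose_sub, conjTranspose_conjTranspose,
      ← neg_sub, smul_neg, ← neg_smul]
    congr 1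
    simp [neg_div]
  have hline : A + Complex.I • Y + (-Complex.I) • (Complex.I • X) = M := by
    rw [hX, hY, smul_smul, smul_smul, smul_smul]
    have h1 : Complex.I * (-Complex.I / 2) = 1 / 2 := by
      linear_combination (-1 / 2 : ℂ) * Complex.I_mul_I
    have h2 : -Complex.I * Complex.I * (1 / 2) = 1 / 2 := by
      linear_combination (-1 / 2 : ℂ) * Complex.I_mul_I
    rw [h1, h2]
    module
  obtain ⟨s, hs⟩ := exists_real_adjoin_eq_top B (A + Complex.I • Y) (Complex.I • X)
    (s₀ := -Complex.I) (by rw [hline, hM])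
  refine ⟨Y + (s : ℂ) • X, hYh.add ?_, ?_⟩
  · rw [IsHermitian, conjTranspose_smul, hXh.eq]
    simp
  · rw [← hs, effective]
    congr 2
    rw [← hA]
    module

/-! ### Fixed states on a full space -/

theorem exists_fixed_of_offDiag (B : Fin r → Matrix (Fin d) (Fin d) ℂ) (hd : d ≠ 0)
    (h : d = 1 ∨ ∃ k i j, i ≠ j ∧ B k i j ≠ 0) :
    ∃ h ρ : Matrix (Fin d) (Fin d) ℂ, h.IsHermitian ∧ ρ.PosDef ∧ ρ.trace = 1 ∧
      generator (effective h B) B ρ = 0 ∧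
      ∀ σ, IsState σ → generator (effective h B) B σ = 0 → σ = ρ := by
  have key : ∃ h : Matrix (Fin d) (Fin d) ℂ, h.IsHermitian ∧
      Algebra.adjoin ℂ (insert (effective h B) (Set.range B)) = ⊤ := by
    rcases h with rfl | ⟨k, i, j, hij, hk⟩
    · refine ⟨0, isHermitian_zero, subalgebra_eq_top_of_single_mem fun i j => ?_⟩
      have h1 : (single i j 1 : Matrix (Fin 1) (Fin 1) ℂ) = 1 := by
        ext a b
        rw [Subsingleton.elim a i, Subsingleton.elim b j, Subsingleton.elim j i]
        simp
      rw [h1]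
      exact one_mem _
    · exact exists_hermitian_adjoin_eq_top B hij hk
  obtain ⟨h, hh, htop⟩ := key
  obtain ⟨ρ, h1, h2, h3, h4⟩ := exists_unique_fixed hd (effective_add_conjTranspose hh B) htop
  exact ⟨h, ρ, hh, h1, h2, h3, h4⟩

/-- Without off-diagonal entries the terms are diagonal, hence normal, so the generator with zero
Hamiltonian annihilates the identity. -/
theorem exists_fixed (B : Fin r → Matrix (Fin d) (Fin d) ℂ) (hd : d ≠ 0) :
    ∃ h ρ : Matrix (Fin d) (Fin d) ℂ, h.IsHermitian ∧ ρ.PosDef ∧ ρ.trace = 1 ∧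
      generator (effective h B) B ρ = 0 := by
  by_cases hB : ∃ k i j, i ≠ j ∧ B k i j ≠ 0
  · obtain ⟨h, ρ, h1, h2, h3, h4, -⟩ := exists_fixed_of_offDiag B hd (Or.inr hB)
    exact ⟨h, ρ, h1, h2, h3, h4⟩
  push Not at hB
  have hd' : (0 : ℂ) < (d : ℂ)⁻¹ := by
    rw [RCLike.inv_pos]
    exact_mod_cast Nat.pos_of_ne_zero hd
  refine ⟨0, (d : ℂ)⁻¹ • 1, isHermitian_zero, PosDef.one.smul hd', ?_, ?_⟩
  · rw [trace_smul, trace_one, Fintype.card_fin, smul_eq_mul, inv_mul_cancel₀]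
    exact_mod_cast hd
  · have hcomm : ∀ k, B k * (B k)ᴴ = (B k)ᴴ * B k := fun k => by
      have h1 : B k = diagonal fun i => B k i i := by
        ext i j
        rcases eq_or_ne i j with rfl | h
        · rw [diagonal_apply_eq]
        · rw [hB k i j h, diagonal_apply_ne _ h]
      rw [h1, diagonal_conjTranspose, diagonal_mul_diagonal, diagonal_mul_diagonal]
      congr 1
      funext i
      exact mul_comm _ _
    rw [generator_smul, generator, Matrix.mul_one, Matrix.one_mul,
      effective_add_conjTranspose isHermitian_zero, ← Finset.sum_sub_distrib, Finset.sum_eq_zero,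
      smul_zero]
    exact fun k _ => by rw [Matrix.mul_one, hcomm, sub_self]

/-! ### Lazy subspaces and isometries -/

theorem isInvariantSubspace_adjoin {s : Set (Matrix (Fin n) (Fin n) ℂ)}
    {S : Submodule ℂ (Fin n → ℂ)} (h : ∀ M ∈ s, ∀ x ∈ S, M *ᵥ x ∈ S) :
    IsInvariantSubspace (Algebra.adjoin ℂ s) S := by
  intro M hM
  induction hM using Algebra.adjoin_induction with
  | mem M hM => exact h M hM
  | algebraMap c =>
    intro x hx
    rw [Algebra.algebraMap_eq_smul_one, smul_mulVec, one_mulVec]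
    exact S.smul_mem c hx
  | add A B _ _ hA hB =>
    intro x hx
    rw [add_mulVec]
    exact S.add_mem (hA x hx) (hB x hx)
  | mul A B _ _ hA hB =>
    intro x hx
    rw [← mulVec_mulVec]
    exact hA _ (hB x hx)

theorem mulVec_mem_range {M : Matrix (Fin n) (Fin n) ℂ} {E : Matrix (Fin n) (Fin d) ℂ}
    {B : Matrix (Fin d) (Fin d) ℂ} (h : M * E = E * B) :
    ∀ x ∈ LinearMap.range E.mulVecLin, M *ᵥ x ∈ LinearMap.range E.mulVecLin := by
  rintro _ ⟨y, rfl⟩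
  refine ⟨B *ᵥ y, ?_⟩
  rw [mulVecLin_apply, mulVecLin_apply, mulVec_mulVec, mulVec_mulVec, h]

theorem finrank_range_isometry {E : Matrix (Fin n) (Fin d) ℂ} (hE : Eᴴ * E = 1) :
    Module.finrank ℂ (LinearMap.range E.mulVecLin) = d := by
  rw [LinearMap.finrank_range_of_inj, Module.finrank_fin_fun]
  exact Function.LeftInverse.injective (g := fun v => Eᴴ *ᵥ v) fun v => by
    simp [mulVec_mulVec, hE]

theorem range_ne_bot {E : Matrix (Fin n) (Fin d) ℂ} (hE : Eᴴ * E = 1) (hd : d ≠ 0) :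
    LinearMap.range E.mulVecLin ≠ ⊥ := by
  intro h
  have h1 := finrank_range_isometry hE
  rw [h, finrank_bot] at h1
  exact hd h1.symm

theorem isLazy_range {V : Fin r → Matrix (Fin n) (Fin n) ℂ} {E : Matrix (Fin n) (Fin d) ℂ}
    (hE : Eᴴ * E = 1) (hd : d ≠ 0) {B : Fin r → Matrix (Fin d) (Fin d) ℂ}
    (hV : ∀ k, V k * E = E * B k) : IsLazy V (LinearMap.range E.mulVecLin) := by
  refine ⟨range_ne_bot hE hd, isInvariantSubspace_adjoin ?_⟩
  rintro _ ⟨k, rfl⟩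
  exact mulVec_mem_range (hV k)

/-- `E * Eᴴ` is the orthogonal projection onto the range of `E`. -/
theorem isometry_mul_cancel {E : Matrix (Fin n) (Fin d) ℂ} (hE : Eᴴ * E = 1) {l : ℕ}
    {M : Matrix (Fin n) (Fin l) ℂ} (hM : ∀ j, M.col j ∈ LinearMap.range E.mulVecLin) :
    E * (Eᴴ * M) = M := by
  ext i j
  obtain ⟨y, hy⟩ := hM j
  have h1 : (E * (Eᴴ * M)).col j = M.col j := by
    have h2 : ∀ {a b : ℕ} (A : Matrix (Fin a) (Fin b) ℂ) (N : Matrix (Fin b) (Fin l) ℂ),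
        (A * N).col j = A *ᵥ N.col j := fun A N => rfl
    rw [h2, h2, ← hy, mulVecLin_apply, mulVec_mulVec, mulVec_mulVec, Matrix.mul_assoc, hE,
      Matrix.mul_one]
  exact congrFun h1 i

theorem exists_isometry (S : Submodule ℂ (Fin n → ℂ)) (hS : Module.finrank ℂ S = d) :
    ∃ E : Matrix (Fin n) (Fin d) ℂ, Eᴴ * E = 1 ∧ LinearMap.range E.mulVecLin = S := by
  let e := (WithLp.linearEquiv 2 ℂ (Fin n → ℂ)).symm
  let S' : Submodule ℂ (EuclideanSpace ℂ (Fin n)) := S.map (e : (Fin n → ℂ) →ₗ[ℂ] _)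
  have hS' : Module.finrank ℂ S' = d := by rw [← hS]; exact LinearEquiv.finrank_map_eq e S
  let b := (stdOrthonormalBasis ℂ S').reindex (finCongr hS')
  let E : Matrix (Fin n) (Fin d) ℂ := of fun i j => (b j : EuclideanSpace ℂ (Fin n)) i
  have hE : Eᴴ * E = 1 := by
    ext i j
    have h := orthonormal_iff_ite.1 b.orthonormal i j
    rw [Submodule.coe_inner, PiLp.inner_apply] at h
    rw [mul_apply, one_apply, ← h]
    refine Finset.sum_congr rfl fun a _ => ?_
    simp [E, mul_comm]
  refine ⟨E, hE, Submodule.eq_of_le_of_finrank_eq ?_ (by rw [finrank_range_isometry hE, hS])⟩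
  rintro _ ⟨y, rfl⟩
  have hsum : E *ᵥ y = ∑ j, y j • Eᵀ j := by
    rw [mulVec_eq_sum]
    exact Finset.sum_congr rfl fun j _ => op_smul_eq_smul _ _
  rw [mulVecLin_apply, hsum]
  refine S.sum_mem fun j _ => ?_
  obtain ⟨x, hx, hxb⟩ := (b j).2
  have : Eᵀ j = x := by
    funext i
    change (b j : EuclideanSpace ℂ (Fin n)) i = x i
    rw [← hxb]
    rfl
  rw [this]
  exact S.smul_mem _ hx

theorem exists_isometry_of_isLazy {V : Fin r → Matrix (Fin n) (Fin n) ℂ}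
    {S : Submodule ℂ (Fin n → ℂ)} (hS : IsLazy V S) (hd : Module.finrank ℂ S = d) :
    ∃ E : Matrix (Fin n) (Fin d) ℂ, Eᴴ * E = 1 ∧ ∀ k, V k * E = E * (Eᴴ * V k * E) := by
  obtain ⟨E, hE, rfl⟩ := exists_isometry S hd
  refine ⟨E, hE, fun k => ?_⟩
  rw [Matrix.mul_assoc Eᴴ, isometry_mul_cancel hE]
  intro j
  refine hS.2 (V k) (Algebra.subset_adjoin ⟨k, rfl⟩) (E.col j) ⟨Pi.single j 1, ?_⟩
  rw [mulVecLin_apply, mulVec_single_one]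

/-! ### Lifting fixed states along an isometry -/

/-- Any Hamiltonian on the range of the isometry `E` is induced by a stabilizing one. -/
theorem exists_stabilizing (H₀ : Matrix (Fin n) (Fin n) ℂ) (hH₀ : H₀.IsHermitian)
    {V : Fin r → Matrix (Fin n) (Fin n) ℂ} {E : Matrix (Fin n) (Fin d) ℂ} (hE : Eᴴ * E = 1)
    {B : Fin r → Matrix (Fin d) (Fin d) ℂ} (hV : ∀ k, V k * E = E * B k)
    {h : Matrix (Fin d) (Fin d) ℂ} (hh : h.IsHermitian) :
    ∃ H : Matrix (Fin n) (Fin n) ℂ, H.IsHermitian ∧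
      effective (H₀ + H) V * E = E * effective h B := by
  have hEE : ∀ {l : ℕ} (M : Matrix (Fin d) (Fin l) ℂ), Eᴴ * (E * M) = M := fun M => by
    rw [← Matrix.mul_assoc, hE, Matrix.one_mul]
  set G := effective H₀ V with hG
  -- `i X` cancels the block of `K` leading from the range of `E` to its orthogonal complement.
  -- Adding `Xᴴ` makes this correction Hermitian and does not act on the range, since `Xᴴ * E = 0`.
  -- The remaining summand of the Hamiltonian replaces the compression of `H₀` by `h`.
  set X : Matrix (Fin n) (Fin n) ℂ := Complex.I • ((1 - E * Eᴴ) * G * (E * Eᴴ)) with hX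
  have hBB : ∀ k, Eᴴ * ((V k)ᴴ * (V k * E)) = (B k)ᴴ * B k := fun k => by
    rw [hV, ← Matrix.mul_assoc, ← conjTranspose_mul, hV, conjTranspose_mul, Matrix.mul_assoc, hEE]
  refine ⟨X + Xᴴ + E * (h - Eᴴ * H₀ * E) * Eᴴ, ?_, ?_⟩
  · refine IsHermitian.add ?_ (isHermitian_mul_mul_conjTranspose E (hh.sub ?_))
    · rw [IsHermitian, conjTranspose_add, conjTranspose_conjTranspose, add_comm]
    · exact isHermitian_conjTranspose_mul_mul E hH₀
  · have hXE : X * E = Complex.I • (G * E - E * (Eᴴ * (G * E))) := by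
      simp only [hX, Matrix.sub_mul, Matrix.one_mul, Matrix.mul_assoc, Matrix.smul_mul, hE,
        Matrix.mul_one]
    have hXE' : Xᴴ * E = 0 := by
      rw [hX, conjTranspose_smul]
      simp only [conjTranspose_mul, conjTranspose_sub, conjTranspose_conjTranspose,
        Matrix.mul_assoc, Matrix.sub_mul, Matrix.one_mul,
        Matrix.smul_mul, hE, Matrix.mul_one, sub_self, smul_zero]
    have hI : Complex.I • X * E = E * (Eᴴ * (G * E)) - G * E := by
      rw [Matrix.smul_mul, hXE, smul_smul, Complex.I_mul_I]
      module
    have hGE : Eᴴ * (G * E) = Complex.I • (Eᴴ * H₀ * E) + (1 / 2 : ℂ) • ∑ k, (B k)ᴴ * B k := by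
      rw [hG, effective]
      simp only [Matrix.add_mul, Matrix.mul_add, Matrix.smul_mul, Matrix.mul_smul, Matrix.sum_mul,
        Matrix.mul_sum, Matrix.mul_assoc, hBB]
    have heff : effective (H₀ + (X + Xᴴ + E * (h - Eᴴ * H₀ * E) * Eᴴ)) V * E =
        G * E + Complex.I • X * E + Complex.I • (Xᴴ * E) +
          Complex.I • (E * (h - Eᴴ * H₀ * E)) := by
      simp only [hG, effective, smul_add, Matrix.add_mul, Matrix.smul_mul, Matrix.mul_assoc, hE,
        Matrix.mul_one]
      abel
    rw [heff, hI, hXE', hGE, effective]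
    simp only [Matrix.mul_add, Matrix.mul_sub, Matrix.mul_smul, smul_sub, smul_zero]
    abel

theorem supp_lift {E : Matrix (Fin n) (Fin d) ℂ} (hE : Eᴴ * E = 1)
    {ρ : Matrix (Fin d) (Fin d) ℂ} (hρ : ρ.PosDef) :
    supp (E * ρ * Eᴴ) = LinearMap.range E.mulVecLin := by
  apply le_antisymm
  · rintro _ ⟨y, rfl⟩
    refine ⟨(ρ * Eᴴ) *ᵥ y, ?_⟩
    rw [mulVecLin_apply, mulVecLin_apply, mulVec_mulVec, Matrix.mul_assoc]
  · rintro _ ⟨y, rfl⟩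
    refine ⟨(E * ρ⁻¹) *ᵥ y, ?_⟩
    rw [mulVecLin_apply, mulVecLin_apply, mulVec_mulVec, Matrix.mul_assoc, ← Matrix.mul_assoc Eᴴ,
      hE, Matrix.one_mul, Matrix.mul_assoc,
      mul_nonsing_inv _ ((isUnit_iff_isUnit_det _).1 hρ.isUnit), Matrix.mul_one]

/-- The lifted state is `E ρ Eᴴ`. Every state supported in the range of `E` has the form `E τ Eᴴ`,
and the generators are intertwined, so uniqueness lifts as well. -/
theorem exists_lift (H₀ : Matrix (Fin n) (Fin n) ℂ) (hH₀ : H₀.IsHermitian)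
    {V : Fin r → Matrix (Fin n) (Fin n) ℂ} {E : Matrix (Fin n) (Fin d) ℂ} (hE : Eᴴ * E = 1)
    (hd : d ≠ 0) {B : Fin r → Matrix (Fin d) (Fin d) ℂ} (hV : ∀ k, V k * E = E * B k)
    {h ρ : Matrix (Fin d) (Fin d) ℂ} (hh : h.IsHermitian) (hρ : ρ.PosDef) (htr : ρ.trace = 1)
    (hfix : generator (effective h B) B ρ = 0) :
    ∃ H R : Matrix (Fin n) (Fin n) ℂ, IsState R ∧ R.rank = d ∧
      IsStabilizingHamiltonian H₀ V (supp R) H ∧ -(iAd H + lindblad H₀ V) R = 0 ∧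
      ((∀ τ, IsState τ → generator (effective h B) B τ = 0 → τ = ρ) →
        ∀ σ, IsState σ → supp σ ≤ supp R → -(iAd H + lindblad H₀ V) σ = 0 → σ = R) := by
  obtain ⟨H, hH, hK⟩ := exists_stabilizing H₀ hH₀ hE hV hh
  have hL : ∀ σ, -(iAd H + lindblad H₀ V) σ =
      -generator (effective (H₀ + H) V) V σ := fun σ => by
    rw [iAd_add_lindblad, lindblad_apply (hH₀.add hH)]
  have hsupp := supp_lift hE hρ
  have htrace : ∀ τ : Matrix (Fin d) (Fin d) ℂ, (E * τ * Eᴴ).trace = τ.trace := fun τ => by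
    rw [trace_mul_comm, ← Matrix.mul_assoc, hE, Matrix.one_mul]
  refine ⟨H, E * ρ * Eᴴ, ⟨hρ.posSemidef.mul_mul_conjTranspose_same E, by rw [htrace, htr]⟩, ?_,
    ⟨hH, ?_⟩, ?_, ?_⟩
  · have h1 := finrank_range_isometry hE
    rw [← hsupp] at h1
    exact h1
  · rw [hsupp]
    refine ⟨range_ne_bot hE hd, isInvariantSubspace_adjoin ?_⟩
    rintro _ (rfl | ⟨k, rfl⟩)
    · exact mulVec_mem_range hK
    · exact mulVec_mem_range (hV k)
  · rw [hL, generator_isometry hV hK, hfix, Matrix.mul_zero, Matrix.zero_mul, neg_zero]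
  · intro huniq σ hσ hσs hσfix
    rw [hsupp] at hσs
    have h1 : E * (Eᴴ * σ) = σ := isometry_mul_cancel hE fun j =>
      hσs ⟨Pi.single j 1, by rw [mulVecLin_apply, mulVec_single_one]⟩
    have h2 : σ * E * Eᴴ = σ := by
      have := congrArg conjTranspose h1
      rwa [conjTranspose_mul, conjTranspose_mul, conjTranspose_conjTranspose,
        hσ.1.isHermitian.eq] at this
    have h3 : E * (Eᴴ * σ * E) * Eᴴ = σ := by
      rw [← Matrix.mul_assoc, h1, h2]
    have h4 : Eᴴ * σ * E = ρ := by
      refine huniq _ ⟨hσ.1.conjTranspose_mul_mul_same E, by rw [← htrace, h3, hσ.2]⟩ ?_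
      rw [hL, neg_eq_zero, ← h3, generator_isometry hV hK] at hσfix
      have h5 : ∀ M : Matrix (Fin d) (Fin d) ℂ, Eᴴ * (E * M * Eᴴ) * E = M := fun M => by
        rw [Matrix.mul_assoc, Matrix.mul_assoc, hE, Matrix.mul_one, ← Matrix.mul_assoc, hE,
          Matrix.one_mul]
      rw [← h5 (generator _ _ _), hσfix, Matrix.mul_zero, Matrix.zero_mul]
    rw [← h3, h4]

/-! ### Faces of the simplex -/

/-- The face of the simplex spanned by the vertices in `I`. -/
def face (I : Finset (Fin n)) : Set (Fin n → ℝ) :=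
  {x | x ∈ stdSimplex ℝ (Fin n) ∧ ∀ i, i ∉ I → x i = 0}

/-- The barycenter of a face. -/
def barycenter (I : Finset (Fin n)) : Fin n → ℝ := fun i => if i ∈ I then (I.card : ℝ)⁻¹ else 0

theorem barycenter_pos {I : Finset (Fin n)} {i : Fin n} (hi : i ∈ I) : 0 < barycenter I i := by
  rw [barycenter, if_pos hi, inv_pos]
  exact_mod_cast Finset.card_pos.2 ⟨i, hi⟩

theorem barycenter_mem {I : Finset (Fin n)} (hI : I.Nonempty) : barycenter I ∈ face I := by
  refine ⟨⟨fun i => ?_, ?_⟩, fun i hi => if_neg hi⟩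
  · by_cases hi : i ∈ I
    · exact (barycenter_pos hi).le
    · exact (if_neg hi).ge
  · simp only [barycenter]
    rw [Finset.sum_ite_mem, Finset.univ_inter, Finset.sum_const, nsmul_eq_mul, mul_inv_cancel₀]
    exact_mod_cast hI.card_ne_zero

theorem eq_zero_of_isTangent {I : Finset (Fin n)} {v : Fin n → ℝ} (hv : IsTangent (face I) v)
    {i : Fin n} (hi : i ∉ I) : v i = 0 := by
  have h : vectorSpan ℝ (face I) ≤ LinearMap.ker (LinearMap.proj (R := ℝ) (φ := fun _ => ℝ) i) := by
    rw [vectorSpan, Submodule.span_le]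
    rintro _ ⟨x, hx, y, hy, rfl⟩
    change x i - y i = 0
    rw [hx.2 i hi, hy.2 i hi, sub_zero]
  exact h hv

theorem isTangent_zero (F : Set (Fin n → ℝ)) : IsTangent F 0 := Submodule.zero_mem _

theorem mem_affineSpan_face {I : Finset (Fin n)} {y : Fin n → ℝ}
    (hy : y ∈ affineSpan ℝ (face I)) : ∑ i, y i = 1 ∧ ∀ i, i ∉ I → y i = 0 := by
  refine affineSpan_induction (p := fun y : Fin n → ℝ => ∑ i, y i = 1 ∧ ∀ i, i ∉ I → y i = 0) hy
    (fun x hx => ⟨hx.1.2, hx.2⟩) ?_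
  · intro c u v w hu hv hw
    constructor
    · simp only [vsub_eq_sub, vadd_eq_add, Pi.add_apply, Pi.smul_apply, Pi.sub_apply, smul_eq_mul,
        Finset.sum_add_distrib, ← Finset.mul_sum, Finset.sum_sub_distrib, hu.1, hv.1, hw.1]
      ring
    · intro i hi
      simp [hu.2 i hi, hv.2 i hi, hw.2 i hi]

theorem mem_intrinsicInterior_face {I : Finset (Fin n)} {x : Fin n → ℝ} (hx : x ∈ face I)
    (hpos : ∀ i ∈ I, 0 < x i) : x ∈ intrinsicInterior ℝ (face I) := by
  refine ⟨⟨x, subset_affineSpan ℝ _ hx⟩, ?_, rfl⟩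
  rw [mem_interior]
  refine ⟨{y | ∀ i ∈ I, 0 < (y : Fin n → ℝ) i}, ?_, ?_, hpos⟩
  · intro y hy
    have h := mem_affineSpan_face y.2
    refine ⟨⟨fun i => ?_, h.1⟩, h.2⟩
    by_cases hi : i ∈ I
    · exact (hy i hi).le
    · exact (h.2 i hi).ge
  · have h : {y : affineSpan ℝ (face I) | ∀ i ∈ I, 0 < (y : Fin n → ℝ) i} =
        ⋂ i ∈ I, {y : affineSpan ℝ (face I) | 0 < (y : Fin n → ℝ) i} := by
      ext y
      simp
    rw [h]
    exact isOpen_biInter_finset fun i _ =>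
      isOpen_lt continuous_const ((continuous_apply i).comp continuous_subtype_val)

/-- If the coordinate vanished, prolonging the segment from the barycenter slightly beyond the point
would make it negative while remaining in the face. -/
theorem pos_of_mem_intrinsicInterior_face {I : Finset (Fin n)} {x : Fin n → ℝ}
    (hx : x ∈ intrinsicInterior ℝ (face I)) {i : Fin n} (hi : i ∈ I) : 0 < x i := by
  obtain ⟨y, hy, rfl⟩ := hx
  have hyF : (y : Fin n → ℝ) ∈ face I := Set.mem_preimage.1 (interior_subset hy)
  refine lt_of_le_of_ne (hyF.1.1 i) fun h0 => ?_
  have hb := subset_affineSpan ℝ (face I) (barycenter_mem ⟨i, hi⟩)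
  let γ : ℝ → affineSpan ℝ (face I) := fun t =>
    ⟨AffineMap.lineMap (y : Fin n → ℝ) (barycenter I) t, AffineMap.lineMap_mem t y.2 hb⟩
  have hγ : Continuous γ := AffineMap.lineMap_continuous.subtype_mk _
  have hγ0 : γ 0 = y := Subtype.ext (AffineMap.lineMap_apply_zero _ _)
  have hmem : ∀ᶠ t in nhds (0 : ℝ), γ t ∈ interior ((↑) ⁻¹' face I : Set (affineSpan ℝ (face I))) :=
    hγ.continuousAt.eventually (by rw [hγ0]; exact isOpen_interior.mem_nhds hy)
  obtain ⟨t, ht, htneg⟩ := ((hmem.filter_mono nhdsWithin_le_nhds).and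
    (self_mem_nhdsWithin : Set.Iio (0 : ℝ) ∈ nhdsWithin 0 (Set.Iio 0))).exists
  have h1 : 0 ≤ (γ t : Fin n → ℝ) i := (Set.mem_preimage.1 (interior_subset ht)).1.1 i
  have h2 : (γ t : Fin n → ℝ) i = t * barycenter I i := by
    simp [γ, AffineMap.lineMap_apply, ← h0]
  rw [h2] at h1
  exact absurd h1 (not_le.2 (mul_neg_of_neg_of_pos htneg (barycenter_pos hi)))

/-! ### Flows of classical generators -/

theorem exp_apply_nonneg_of_nonneg {X : Matrix (Fin n) (Fin n) ℝ} (h : ∀ i j, 0 ≤ X i j)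
    (i j : Fin n) : 0 ≤ NormedSpace.exp X i j := by
  let P : Subsemiring (Matrix (Fin n) (Fin n) ℝ) :=
    { carrier := {M | ∀ i j, 0 ≤ M i j}
      mul_mem' := fun {A B} hA hB i j => by
        rw [mul_apply]
        exact Finset.sum_nonneg fun k _ => mul_nonneg (hA i k) (hB k j)
      one_mem' := fun i j => by rw [one_apply]; split_ifs <;> simp
      add_mem' := fun hA hB i j => add_nonneg (hA i j) (hB i j)
      zero_mem' := fun i j => le_rfl }
  have hP : IsClosed (P : Set (Matrix (Fin n) (Fin n) ℝ)) := by
    have : (P : Set (Matrix (Fin n) (Fin n) ℝ)) = ⋂ i, ⋂ j, {M | 0 ≤ M i j} := by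
      ext M
      simp only [Set.mem_iInter]
      rfl
    rw [this]
    exact isClosed_iInter fun i => isClosed_iInter fun j =>
      isClosed_le continuous_const ((continuous_apply j).comp (continuous_apply i))
  have hmem : NormedSpace.exp X ∈ P := by
    rw [NormedSpace.exp_eq_tsum ℝ]
    refine tsum_mem hP fun k i j => ?_
    exact mul_nonneg (by positivity) (P.pow_mem (x := X) h k i j)
  exact hmem i j

/-- Adding a large scalar matrix makes all entries nonnegative and only multiplies the exponential
by a positive number. -/
theorem exp_apply_nonneg {X : Matrix (Fin n) (Fin n) ℝ} (h : ∀ i j, i ≠ j → 0 ≤ X i j)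
    (i j : Fin n) : 0 ≤ NormedSpace.exp X i j := by
  set c : ℝ := ∑ i, |X i i| with hc
  have h1 : X = (X + diagonal fun _ => c) + diagonal fun _ => -c := by
    rw [add_assoc, diagonal_add]
    simp
  have h2 : ∀ i j, 0 ≤ (X + diagonal fun _ => c : Matrix (Fin n) (Fin n) ℝ) i j := fun i j => by
    rw [Matrix.add_apply]
    rcases eq_or_ne i j with rfl | hij
    · rw [diagonal_apply_eq]
      have h3 := Finset.single_le_sum (fun i _ => abs_nonneg (X i i)) (Finset.mem_univ i)
      have h4 := neg_abs_le (X i i)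
      linarith
    · rw [diagonal_apply_ne _ hij, add_zero]
      exact h i j hij
  rw [h1, Matrix.exp_add_of_commute, exp_diagonal, mul_diagonal]
  · refine mul_nonneg (exp_apply_nonneg_of_nonneg h2 i j) ?_
    rw [Pi.exp_def, ← Real.exp_eq_exp_ℝ]
    exact (Real.exp_pos _).le
  · have h3 : (diagonal fun _ => -c : Matrix (Fin n) (Fin n) ℝ) = (-c) • 1 := by
      rw [← diagonal_one, ← diagonal_smul]
      congr 1
      funext i
      simp
    rw [h3]
    exact (Commute.one_right _).smul_right _

theorem hasDerivAt_exp_mulVec (X : Matrix (Fin n) (Fin n) ℝ) (x : Fin n → ℝ) (t : ℝ) :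
    HasDerivAt (fun s : ℝ => NormedSpace.exp (s • X) *ᵥ x)
      (X *ᵥ (NormedSpace.exp (t • X) *ᵥ x)) t := by
  let _ : NormedRing (Matrix (Fin n) (Fin n) ℝ) := Matrix.linftyOpNormedRing
  let _ : NormedAlgebra ℝ (Matrix (Fin n) (Fin n) ℝ) := Matrix.linftyOpNormedAlgebra
  let T : Matrix (Fin n) (Fin n) ℝ →ₗ[ℝ] (Fin n → ℝ) :=
    { toFun := fun M => M *ᵥ x
      map_add' := fun A B => add_mulVec A B x
      map_smul' := fun c A => smul_mulVec c A x }
  have h := (LinearMap.toContinuousLinearMap T).hasFDerivAt.comp_hasDerivAt t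
    (hasDerivAt_exp_smul_const' X t)
  rw [mulVec_mulVec]
  exact h

theorem mulVec_eq_sum_apply (X : Matrix (Fin n) (Fin n) ℝ) (x : Fin n → ℝ) (i : Fin n) :
    (X *ᵥ x) i = ∑ j, X i j * x j := rfl

/-- Positivity comes from the off-diagonal signs, conservation of mass from the vanishing sums, and
the zero coordinates from the exponential staying in the closed block subalgebra. -/
theorem flowLeavesInvariant_face {X : Matrix (Fin n) (Fin n) ℝ} {I : Finset (Fin n)}
    (hoff : ∀ i j, i ≠ j → 0 ≤ X i j) (hsum : ∀ x, ∑ i, (X *ᵥ x) i = 0)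
    (hI : ∀ i ∉ I, ∀ j ∈ I, X i j = 0) : FlowLeavesInvariant X (face I) := by
  intro t ht x hx
  have hnn : ∀ i j, 0 ≤ NormedSpace.exp (t • X) i j :=
    exp_apply_nonneg fun i j hij => mul_nonneg ht (hoff i j hij)
  have hblock : NormedSpace.exp (t • X) ∈ blockSubalgebra ℝ (I : Set (Fin n)) := by
    refine NormedSpace.exp_mem (R := ℝ) (s := blockSubalgebra ℝ (I : Set (Fin n)))
      (Submodule.closed_of_finiteDimensional
        (Subalgebra.toSubmodule (blockSubalgebra ℝ (I : Set (Fin n))))) ?_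
    have hX : X ∈ blockSubalgebra ℝ (I : Set (Fin n)) := fun j hj i hi => hI i hi j hj
    exact Subalgebra.smul_mem _ hX t
  refine ⟨⟨fun i => ?_, ?_⟩, ?_⟩
  · rw [mulVec_eq_sum_apply]
    exact Finset.sum_nonneg fun j _ => mul_nonneg (hnn i j) (hx.1.1 j)
  · have hderiv : ∀ s : ℝ, HasDerivAt (fun s : ℝ => ∑ i, (NormedSpace.exp (s • X) *ᵥ x) i) 0 s := by
      intro s
      rw [← hsum (NormedSpace.exp (s • X) *ᵥ x)]
      exact HasDerivAt.fun_sum fun i _ => hasDerivAt_pi.1 (hasDerivAt_exp_mulVec X x s) i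
    have h := is_const_of_deriv_eq_zero (fun s => (hderiv s).differentiableAt)
      (fun s => (hderiv s).deriv) t 0
    rw [h, zero_smul, NormedSpace.exp_zero, one_mulVec]
    exact hx.1.2
  · intro i hi
    rw [mulVec_eq_sum_apply]
    refine Finset.sum_eq_zero fun j _ => ?_
    by_cases hj : j ∈ I
    · exact mul_eq_zero_of_left (hblock j hj i hi) _
    · exact mul_eq_zero_of_right _ (hx.2 j hj)

/-! ### Induced vector fields and faces -/

/-- Multiplying `U` by an `n`-th root of the conjugate of `det U` normalizes the determinant; the
phase cancels in the induced field. -/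
theorem exists_specialUnitary {U : Matrix (Fin n) (Fin n) ℂ} (hn : n ≠ 0)
    (hU : U ∈ unitaryGroup (Fin n) ℂ)
    (L : Matrix (Fin n) (Fin n) ℂ →ₗ[ℂ] Matrix (Fin n) (Fin n) ℂ) :
    ∃ U' ∈ specialUnitaryGroup (Fin n) ℂ, inducedField L U' = inducedField L U := by
  have hdet : star U.det * U.det = 1 := (Unitary.mem_iff.1 (det_of_mem_unitary hU)).1
  obtain ⟨c, hc⟩ := IsAlgClosed.exists_pow_nat_eq (star U.det) (Nat.pos_of_ne_zero hn)
  have hc1 : c * star c = 1 := by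
    have h1 : ‖U.det‖ = 1 := by
      have h := congrArg norm hdet
      rw [norm_mul, norm_star, norm_one] at h
      nlinarith [norm_nonneg U.det]
    have h2 : ‖c‖ ^ n = 1 := by rw [← norm_pow, hc, norm_star, h1]
    have h3 : ‖c‖ = 1 := (pow_eq_one_iff_of_nonneg (norm_nonneg c) hn).1 h2
    rw [Complex.star_def, Complex.mul_conj, Complex.normSq_eq_norm_sq, h3]
    simp
  have hc2 : star c * c = 1 := by rw [mul_comm, hc1]
  refine ⟨c • U, mem_specialUnitaryGroup_iff.2 ⟨mem_unitaryGroup_iff'.2 ?_, ?_⟩, ?_⟩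
  · rw [star_smul, smul_mul_smul_comm, hc2, mem_unitaryGroup_iff'.1 hU, one_smul]
  · rw [det_smul, Fintype.card_fin, hc, hdet]
  · have h : ∀ A : Matrix (Fin n) (Fin n) ℂ,
        (c • U)ᴴ * L (c • U * A * (c • U)ᴴ) * (c • U) = Uᴴ * L (U * A * Uᴴ) * U := fun A => by
      simp only [conjTranspose_smul, Matrix.smul_mul, Matrix.mul_smul, smul_smul, hc1, hc2,
        one_smul]
    have h' : inducedMap L (c • U) = inducedMap L U := by
      refine LinearMap.ext fun x => funext fun i => ?_
      change -(((c • U)ᴴ * L (c • U * diagonal (fun j => (x j : ℂ)) * (c • U)ᴴ) * (c • U)) i i).re =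
        -((Uᴴ * L (U * diagonal (fun j => (x j : ℂ)) * Uᴴ) * U) i i).re
      rw [h]
    rw [inducedField, h', inducedField]

theorem inducedField_apply_of_ne {H₀ : Matrix (Fin n) (Fin n) ℂ} (hH : H₀.IsHermitian)
    (V : Fin r → Matrix (Fin n) (Fin n) ℂ) {U : Matrix (Fin n) (Fin n) ℂ}
    (hU : U ∈ unitaryGroup (Fin n) ℂ) {i j : Fin n} (hij : i ≠ j) :
    inducedField (lindblad H₀ V) U i j = jumpRate (conjTerms V U) i j := by
  have h := inducedField_mulVec hH V hU (Pi.single j 1) i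
  rw [mulVec_single_one, Finset.sum_sub_distrib, Finset.sum_eq_single j, Finset.sum_eq_zero] at h
  · simpa using h
  · intro a _
    rw [Pi.single_eq_of_ne hij, mul_zero]
  · intro a _ ha
    rw [Pi.single_eq_of_ne ha, mul_zero]
  · simp

theorem sum_inducedField_mulVec {H₀ : Matrix (Fin n) (Fin n) ℂ} (hH : H₀.IsHermitian)
    (V : Fin r → Matrix (Fin n) (Fin n) ℂ) {U : Matrix (Fin n) (Fin n) ℂ}
    (hU : U ∈ unitaryGroup (Fin n) ℂ) (x : Fin n → ℝ) :
    ∑ i, (inducedField (lindblad H₀ V) U *ᵥ x) i = 0 := by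
  simp only [inducedField_mulVec hH V hU, Finset.sum_sub_distrib]
  rw [Finset.sum_comm, sub_self]

theorem inducedField_mulVec_of_eq_zero {H₀ : Matrix (Fin n) (Fin n) ℂ} (hH : H₀.IsHermitian)
    (V : Fin r → Matrix (Fin n) (Fin n) ℂ) {U : Matrix (Fin n) (Fin n) ℂ}
    (hU : U ∈ unitaryGroup (Fin n) ℂ) {x : Fin n → ℝ} {i : Fin n} (hi : x i = 0) :
    (inducedField (lindblad H₀ V) U *ᵥ x) i = ∑ j, jumpRate (conjTerms V U) i j * x j := by
  simp [inducedField_mulVec hH V hU, hi]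

/-- The columns of `U` with indices in `I` span an invariant subspace of all Lindblad terms. -/
def Reduces (V : Fin r → Matrix (Fin n) (Fin n) ℂ) (I : Finset (Fin n))
    (U : Matrix (Fin n) (Fin n) ℂ) : Prop :=
  ∀ i ∉ I, ∀ j ∈ I, ∀ k, conjTerms V U k i j = 0

theorem reduces_of_mulVec_eq_zero {H₀ : Matrix (Fin n) (Fin n) ℂ} (hH : H₀.IsHermitian)
    {V : Fin r → Matrix (Fin n) (Fin n) ℂ} {U : Matrix (Fin n) (Fin n) ℂ}
    (hU : U ∈ unitaryGroup (Fin n) ℂ) {I : Finset (Fin n)} {x : Fin n → ℝ} (hx : x ∈ face I)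
    (hpos : ∀ i ∈ I, 0 < x i)
    (h : ∀ i ∉ I, (inducedField (lindblad H₀ V) U *ᵥ x) i = 0) : Reduces V I U := by
  intro i hi j hj
  have h1 := h i hi
  rw [inducedField_mulVec_of_eq_zero hH V hU (hx.2 i hi), Finset.sum_eq_zero_iff_of_nonneg
    fun j _ => mul_nonneg (jumpRate_nonneg _ _ _) (hx.1.1 j)] at h1
  exact jumpRate_eq_zero_iff.1
    ((mul_eq_zero.1 (h1 j (Finset.mem_univ j))).resolve_right (hpos j hj).ne')

/-- Were no unitary reducing, the total inflow `f` outside `I` would be strictly positive on `𝔏`,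
hence on its convex hull, contradicting `f X = 0`. -/
theorem exists_reduces_of_convexHull {H₀ : Matrix (Fin n) (Fin n) ℂ} (hH : H₀.IsHermitian)
    {V : Fin r → Matrix (Fin n) (Fin n) ℂ} {X : Matrix (Fin n) (Fin n) ℝ}
    (hX : X ∈ convexHull ℝ (inducedFields (lindblad H₀ V))) {I : Finset (Fin n)} {x : Fin n → ℝ}
    (hx : x ∈ face I) (hpos : ∀ i ∈ I, 0 < x i) (h : ∀ i ∉ I, (X *ᵥ x) i = 0) :
    ∃ U ∈ unitaryGroup (Fin n) ℂ, Reduces V I U := by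
  let f : Matrix (Fin n) (Fin n) ℝ →ₗ[ℝ] ℝ :=
    { toFun := fun M => ∑ i ∈ Iᶜ, (M *ᵥ x) i
      map_add' := fun A B => by simp [add_mulVec, Finset.sum_add_distrib]
      map_smul' := fun c A => by simp [smul_mulVec, Finset.mul_sum] }
  by_contra! hno
  have hsub : convexHull ℝ (inducedFields (lindblad H₀ V)) ⊆ {M | 0 < f M} := by
    refine convexHull_min ?_ (convex_halfSpace_gt f.isLinear 0)
    rintro _ ⟨U, hU, rfl⟩
    have hU' := (mem_specialUnitaryGroup_iff.1 hU).1
    have hnn : ∀ i ∈ Iᶜ, 0 ≤ (inducedField (lindblad H₀ V) U *ᵥ x) i := fun i hi => by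
      rw [inducedField_mulVec_of_eq_zero hH V hU' (hx.2 i (Finset.mem_compl.1 hi))]
      exact Finset.sum_nonneg fun j _ => mul_nonneg (jumpRate_nonneg _ _ _) (hx.1.1 j)
    refine lt_of_le_of_ne (Finset.sum_nonneg hnn) fun h0 => hno U hU' ?_
    exact reduces_of_mulVec_eq_zero hH hU' hx hpos fun i hi =>
      (Finset.sum_eq_zero_iff_of_nonneg hnn).1 h0.symm i (Finset.mem_compl.2 hi)
  have h1 : 0 < f X := hsub hX
  have h2 : f X = 0 := Finset.sum_eq_zero fun i hi => h i (Finset.mem_compl.1 hi)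
  exact h1.ne' h2

/-- A reducing unitary gives an isometry onto an invariant subspace. -/
theorem exists_isometry_of_reduces {V : Fin r → Matrix (Fin n) (Fin n) ℂ} {I : Finset (Fin n)}
    {U : Matrix (Fin n) (Fin n) ℂ} (hU : U ∈ unitaryGroup (Fin n) ℂ) (h : Reduces V I U)
    (hd : I.card = d) :
    ∃ (e : Fin d ≃ I) (E : Matrix (Fin n) (Fin d) ℂ), Eᴴ * E = 1 ∧
      ∀ k, V k * E = E * (conjTerms V U k).submatrix (fun a => (e a : Fin n)) (fun a => e a) := by
  let e : Fin d ≃ I := (I.equivFinOfCardEq hd).symm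
  refine ⟨e, U.submatrix id (fun a => (e a : Fin n)), ?_, fun k => ?_⟩
  · have h1 : (U.submatrix id (fun a => (e a : Fin n)))ᴴ * U.submatrix id (fun a => (e a : Fin n)) =
        (Uᴴ * U).submatrix (fun a => (e a : Fin n)) (fun a => e a) := rfl
    rw [h1, conjTranspose_mul_self_of_mem hU]
    exact submatrix_one _ (Subtype.val_injective.comp e.injective)
  · ext i b
    have h1 : V k * U = U * conjTerms V U k := by
      rw [conjTerms, ← Matrix.mul_assoc, ← Matrix.mul_assoc, mul_conjTranspose_self_of_mem hU,
        Matrix.one_mul]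
    have h2 : (V k * U.submatrix id fun a => (e a : Fin n)) i b = (V k * U) i (e b) := rfl
    rw [h2, h1, mul_apply, mul_apply]
    simp only [submatrix_apply, id_eq]
    rw [e.sum_comp (fun a : I => U i a * conjTerms V U k a (e b)),
      Finset.sum_coe_sort I (fun a => U i a * conjTerms V U k a (e b))]
    refine (Finset.sum_subset (Finset.subset_univ I) fun a _ ha => ?_).symm
    rw [h a ha _ (e b).2 k, mul_zero]

theorem exists_isLazy_of_reduces {V : Fin r → Matrix (Fin n) (Fin n) ℂ} {I : Finset (Fin n)}
    {U : Matrix (Fin n) (Fin n) ℂ} (hU : U ∈ unitaryGroup (Fin n) ℂ) (h : Reduces V I U)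
    (hd : I.card = d) (hd0 : d ≠ 0) :
    ∃ S : Submodule ℂ (Fin n → ℂ), IsLazy V S ∧ Module.finrank ℂ S = d := by
  obtain ⟨e, E, hE, hV⟩ := exists_isometry_of_reduces hU h hd
  exact ⟨_, isLazy_range hE hd0 hV, finrank_range_isometry hE⟩

theorem flowLeavesInvariant_of_reduces {H₀ : Matrix (Fin n) (Fin n) ℂ} (hH : H₀.IsHermitian)
    {V : Fin r → Matrix (Fin n) (Fin n) ℂ} {I : Finset (Fin n)}
    {U : Matrix (Fin n) (Fin n) ℂ} (hU : U ∈ unitaryGroup (Fin n) ℂ) (h : Reduces V I U) :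
    FlowLeavesInvariant (inducedField (lindblad H₀ V) U) (face I) := by
  refine flowLeavesInvariant_face (fun i j hij => ?_) (sum_inducedField_mulVec hH V hU)
    fun i hi j hj => ?_
  · rw [inducedField_apply_of_ne hH V hU hij]
    exact jumpRate_nonneg _ _ _
  · rw [inducedField_apply_of_ne hH V hU (by rintro rfl; exact hi hj)]
    exact jumpRate_eq_zero_iff.2 (h i hi j hj)

/-! ### Viability -/

theorem exists_mulVec_of_mem_convexHull_derv
    {L : Matrix (Fin n) (Fin n) ℂ →ₗ[ℂ] Matrix (Fin n) (Fin n) ℂ} {x v : Fin n → ℝ} :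
    v ∈ convexHull ℝ (derv L x) ↔ ∃ X ∈ convexHull ℝ (inducedFields L), X *ᵥ x = v := by
  let T : Matrix (Fin n) (Fin n) ℝ →ₗ[ℝ] (Fin n → ℝ) :=
    { toFun := fun M => M *ᵥ x
      map_add' := fun A B => add_mulVec A B x
      map_smul' := fun c A => smul_mulVec c A x }
  have h : derv L x = T '' inducedFields L := by
    ext w
    constructor
    · rintro ⟨X, hX, rfl⟩
      exact ⟨X, hX, rfl⟩
    · rintro ⟨X, hX, rfl⟩
      exact ⟨X, hX, rfl⟩
  rw [h, ← T.image_convexHull]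
  rfl

theorem isViable_of_flow {L : Matrix (Fin n) (Fin n) ℂ →ₗ[ℂ] Matrix (Fin n) (Fin n) ℂ}
    {X : Matrix (Fin n) (Fin n) ℝ} (hX : X ∈ convexHull ℝ (inducedFields L)) {I : Finset (Fin n)}
    (h : FlowLeavesInvariant X (face I)) : IsViable L (face I) := by
  intro x₀ hx₀
  have hderiv := hasDerivAt_exp_mulVec X x₀
  refine ⟨fun t => NormedSpace.exp (t • X) *ᵥ x₀, ⟨fun t ht => (h t ht x₀ hx₀).1, fun T _ => ?_, ?_⟩,
    by simp, fun t ht => h t ht x₀ hx₀⟩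
  · have hdiff : Differentiable ℝ fun t : ℝ => NormedSpace.exp (t • X) *ᵥ x₀ :=
      fun t => (hderiv t).differentiableAt
    refine ContDiffOn.absolutelyContinuousOnInterval (ContDiff.contDiffOn ?_)
    refine contDiff_one_iff_deriv.2 ⟨hdiff, ?_⟩
    rw [funext fun t => (hderiv t).deriv]
    exact continuous_const.matrix_mulVec hdiff.continuous
  · exact Filter.Eventually.of_forall fun t =>
      ⟨_, exists_mulVec_of_mem_convexHull_derv.2 ⟨X, hX, rfl⟩, hderiv t⟩

/-- A solution starting at the barycenter stays in the relative interior for a short time. This time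
interval has positive measure, so the inclusion holds somewhere in it; there the coordinates outside
`I` are locally constant and have zero derivative. -/
theorem exists_mulVec_eq_zero_of_isViable
    {L : Matrix (Fin n) (Fin n) ℂ →ₗ[ℂ] Matrix (Fin n) (Fin n) ℂ} {I : Finset (Fin n)}
    (hI : I.Nonempty) (h : IsViable L (face I)) :
    ∃ X ∈ convexHull ℝ (inducedFields L), ∃ x ∈ face I, (∀ i ∈ I, 0 < x i) ∧
      ∀ i ∉ I, (X *ᵥ x) i = 0 := by
  obtain ⟨x, ⟨-, hac, hae⟩, hx0, hxF⟩ := h _ (barycenter_mem hI)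
  have hcont : ContinuousWithinAt x (Set.Ioi 0) 0 := by
    have h1 := (hac 1 zero_le_one).continuousOn 0 Set.left_mem_uIcc
    rw [Set.uIcc_of_le zero_le_one] at h1
    have h2 : ContinuousWithinAt x (Set.Ioo 0 1) 0 := h1.mono Set.Ioo_subset_Icc_self
    rwa [continuousWithinAt_Ioo_iff_Ioi zero_lt_one] at h2
  have hpos : ∀ᶠ t in nhdsWithin (0 : ℝ) (Set.Ioi 0), ∀ i ∈ I, 0 < x t i := by
    rw [Filter.eventually_all_finset]
    intro i hi
    have h1 : Filter.Tendsto (fun t => x t i) (nhdsWithin 0 (Set.Ioi 0)) (nhds (x 0 i)) :=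
      ((continuous_apply i).tendsto _).comp hcont
    refine h1.eventually (lt_mem_nhds ?_)
    rw [hx0]
    exact barycenter_pos hi
  obtain ⟨ε, hε, hεpos⟩ := mem_nhdsGT_iff_exists_Ioo_subset.1 hpos
  have hae' : ∀ᵐ t ∂(volume.restrict (Set.Ioo 0 ε)),
      ∃ v ∈ convexHull ℝ (derv L (x t)), HasDerivAt x v t :=
    ae_restrict_of_ae_restrict_of_subset (fun t ht => ht.1.le) hae
  have hne : (volume.restrict (Set.Ioo 0 ε)) ≠ 0 := by
    rw [Ne, Measure.restrict_eq_zero, Real.volume_Ioo, sub_zero, ENNReal.ofReal_eq_zero, not_le]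
    exact hε
  have : (ae (volume.restrict (Set.Ioo 0 ε))).NeBot := ae_neBot.2 hne
  obtain ⟨t, ⟨v, hv, hderiv⟩, ht⟩ := (hae'.and (ae_restrict_mem measurableSet_Ioo)).exists
  obtain ⟨X, hX, rfl⟩ := exists_mulVec_of_mem_convexHull_derv.1 hv
  refine ⟨X, hX, x t, hxF t ht.1.le, hεpos ht, fun i hi => ?_⟩
  have h1 : HasDerivAt (fun s => x s i) ((X *ᵥ x t) i) t := hasDerivAt_pi.1 hderiv i
  have h2 : (fun s => x s i) =ᶠ[nhds t] fun _ => 0 := by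
    filter_upwards [Ioi_mem_nhds ht.1] with s hs
    exact (hxF s (le_of_lt hs)).2 i hi
  exact h1.unique ((hasDerivAt_const t (0 : ℝ)).congr_of_eventuallyEq h2)

/-! ### Fixed states give strongly stabilizable points -/

theorem exists_unitary_face {ρ : Matrix (Fin n) (Fin n) ℂ} (hρ : IsState ρ) {I : Finset (Fin n)}
    (hrank : ρ.rank = I.card) :
    ∃ U ∈ unitaryGroup (Fin n) ℂ, ∃ x ∈ face I, (∀ i ∈ I, 0 < x i) ∧
      ρ = U * diagonal (fun a => (x a : ℂ)) * Uᴴ := by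
  have hZ := hρ.1.isHermitian
  obtain ⟨U, hU, hUρ⟩ := exists_unitary_diagonal hZ
  have hcard : Fintype.card I = Fintype.card {i // hZ.eigenvalues i ≠ 0} := by
    rw [Fintype.card_coe, ← hrank, hZ.rank_eq_card_non_zero_eigs]
  -- The eigenvectors are permuted so that the nonzero eigenvalues sit exactly at the indices in
  -- `I`.
  let f : {i // i ∈ I} ≃ {i // hZ.eigenvalues i ≠ 0} := Fintype.equivOfCardEq hcard
  let p : Equiv.Perm (Fin n) := f.extendSubtype
  have hnn := hρ.1.eigenvalues_nonneg
  refine ⟨U.submatrix id p, ?_, fun i => hZ.eigenvalues (p i), ⟨⟨fun i => hnn _, ?_⟩, ?_⟩, ?_, ?_⟩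
  · rw [mem_unitaryGroup_iff]
    change U.submatrix id p * (Uᴴ).submatrix p id = 1
    rw [submatrix_mul_equiv, mul_conjTranspose_self_of_mem hU, submatrix_id_id]
  · rw [Equiv.sum_comp p hZ.eigenvalues]
    have h1 := hZ.trace_eq_sum_eigenvalues
    rw [hρ.2, ← RCLike.ofReal_sum, ← RCLike.ofReal_one, RCLike.ofReal_inj] at h1
    exact h1.symm
  · intro i hi
    by_contra h
    exact f.extendSubtype_not_mem i hi h
  · intro i hi
    exact lt_of_le_of_ne (hnn _) (Ne.symm (f.extendSubtype_mem i hi))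
  · have h1 : (diagonal fun a => (hZ.eigenvalues (p a) : ℂ)) =
        (diagonal fun a => (hZ.eigenvalues a : ℂ)).submatrix p p :=
      (submatrix_diagonal_equiv (fun a => (hZ.eigenvalues a : ℂ)) p).symm
    have h2 : (U.submatrix id p)ᴴ = (Uᴴ).submatrix p id := rfl
    rw [h1, h2, submatrix_mul_equiv, submatrix_mul_equiv, submatrix_id_id]
    exact hUρ

/-- In an eigenbasis of the state, the diagonal of the fixed-point equation involves only the jump
rates, which do not depend on `H`. It therefore states the equilibrium of the field induced by the
original generator. -/
theorem exists_stabilizable_of_fixed (hn : n ≠ 0) {H₀ H ρ : Matrix (Fin n) (Fin n) ℂ}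
    (hH₀ : H₀.IsHermitian) (hH : H.IsHermitian) (V : Fin r → Matrix (Fin n) (Fin n) ℂ)
    (hρ : IsState ρ) {I : Finset (Fin n)} (hrank : ρ.rank = I.card)
    (hfix : -(iAd H + lindblad H₀ V) ρ = 0) :
    ∃ U ∈ specialUnitaryGroup (Fin n) ℂ, ∃ x ∈ face I, (∀ i ∈ I, 0 < x i) ∧
      inducedField (lindblad H₀ V) U *ᵥ x = 0 := by
  obtain ⟨U, hU, x, hx, hpos, rfl⟩ := exists_unitary_face hρ hrank
  obtain ⟨U', hU', hUU'⟩ := exists_specialUnitary hn hU (lindblad H₀ V)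
  refine ⟨U', hU', x, hx, hpos, funext fun i => ?_⟩
  rw [neg_eq_zero, iAd_add_lindblad, lindblad_apply (hH₀.add hH), generator_conj hU] at hfix
  have h1 : ∀ A : Matrix (Fin n) (Fin n) ℂ, Uᴴ * (U * A * Uᴴ) * U = A := fun A => by
    rw [Matrix.mul_assoc, Matrix.mul_assoc, conjTranspose_mul_self_of_mem hU, Matrix.mul_one,
      ← Matrix.mul_assoc, conjTranspose_mul_self_of_mem hU, Matrix.one_mul]
  have h2 := generator_diagonal_apply_same
    (conj_add_conjTranspose hU (effective_add_conjTranspose (hH₀.add hH) V)) x i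
  rw [← h1 (generator _ _ _), hfix, Matrix.mul_zero, Matrix.zero_mul, Matrix.zero_apply] at h2
  have h3 : (0 : ℝ) = -∑ j, (jumpRate (conjTerms V U) i j * x j -
    jumpRate (conjTerms V U) j i * x i) := by exact_mod_cast h2
  rw [hUU', inducedField_mulVec hH₀ V hU, Pi.zero_apply]
  linarith

/-! ### Faces that are not purely Hamiltonian -/

/-- Tangency at the barycenter makes `U` reducing. If all terms were diagonal on the block `I`, no
rates would remain there and the field would vanish on the face. -/
theorem exists_offDiag_of_not_purelyHamiltonian {H₀ : Matrix (Fin n) (Fin n) ℂ}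
    (hH₀ : H₀.IsHermitian) {V : Fin r → Matrix (Fin n) (Fin n) ℂ} {I : Finset (Fin n)}
    (hI : I.Nonempty) (hviable : IsViable (lindblad H₀ V) (face I))
    (h : ¬ IsPurelyHamiltonianFace (lindblad H₀ V) (face I)) :
    ∃ U ∈ unitaryGroup (Fin n) ℂ, Reduces V I U ∧
      ∃ k, ∃ i ∈ I, ∃ j ∈ I, i ≠ j ∧ conjTerms V U k i j ≠ 0 := by
  simp only [IsPurelyHamiltonianFace, not_and, not_forall] at h
  obtain ⟨X, ⟨U, hU, rfl⟩, htan, x, hx, hne⟩ := h hviable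
  have hU' := (mem_specialUnitaryGroup_iff.1 hU).1
  have hred : Reduces V I U := reduces_of_mulVec_eq_zero hH₀ hU' (barycenter_mem hI)
    (fun i hi => barycenter_pos hi) fun i hi => eq_zero_of_isTangent (htan _ (barycenter_mem hI)) hi
  refine ⟨U, hU', hred, ?_⟩
  by_contra! hdiag
  have hJ : ∀ i ∈ I, ∀ j ∈ I, i ≠ j → jumpRate (conjTerms V U) i j = 0 := fun i hi j hj hij =>
    jumpRate_eq_zero_iff.2 fun k => hdiag k i hi j hj hij
  refine hne (funext fun i => ?_)
  by_cases hi : i ∈ I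
  · rw [inducedField_mulVec hH₀ V hU', Pi.zero_apply]
    refine Finset.sum_eq_zero fun j _ => ?_
    rcases eq_or_ne i j with rfl | hij
    · rw [sub_self]
    by_cases hj : j ∈ I
    · rw [hJ i hi j hj hij, hJ j hj i hi hij.symm, zero_mul, zero_mul, sub_zero]
    · rw [hx.2 j hj, jumpRate_eq_zero_iff.2 (hred j hj i hi), mul_zero, zero_mul, sub_zero]
  · exact eq_zero_of_isTangent (htan x hx) hi

end GKSL

end

/-! ### The cycle of implications -/

theorem mainTheorem6 (n r d : ℕ) (hn : 2 ≤ n)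
    (H₀ : Matrix (Fin n) (Fin n) ℂ) (hH₀ : H₀.IsHermitian)
    (V : Fin r → Matrix (Fin n) (Fin n) ℂ)
    (L : Matrix (Fin n) (Fin n) ℂ →ₗ[ℂ] Matrix (Fin n) (Fin n) ℂ) (hL : L = lindblad H₀ V)
    (F : Set (Fin n → ℝ)) (hF : IsFace d F) :
    -- in general, with the last condition stated without uniqueness
    List.TFAE [
      IsViable L F,
      ∃ X ∈ convexHull ℝ (inducedFields L), FlowLeavesInvariant X F,
      ∃ S : Submodule ℂ (Fin n → ℂ), IsLazy V S ∧ Module.finrank ℂ S = d,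
      ∃ x ∈ intrinsicInterior ℝ F, IsStabilizable L x,
      ∃ x ∈ intrinsicInterior ℝ F, IsStronglyStabilizable L x,
      ∃ X ∈ convexHull ℝ (inducedFields L), ∃ x ∈ intrinsicInterior ℝ F, IsTangent F (X *ᵥ x),
      ∃ U ∈ unitaryGroup (Fin n) ℂ, ∃ x ∈ intrinsicInterior ℝ F,
        IsTangent F (inducedField L U *ᵥ x),
      ∃ H ρ : Matrix (Fin n) (Fin n) ℂ, IsState ρ ∧ ρ.rank = d ∧
        IsStabilizingHamiltonian H₀ V (supp ρ) H ∧ -(iAd H + L) ρ = 0] ∧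
    -- with uniqueness, unless `d ≥ 2` and the face is purely Hamiltonian
    (¬ (2 ≤ d ∧ IsPurelyHamiltonianFace L F) →
      List.TFAE [
        IsViable L F,
        ∃ X ∈ convexHull ℝ (inducedFields L), FlowLeavesInvariant X F,
        ∃ S : Submodule ℂ (Fin n → ℂ), IsLazy V S ∧ Module.finrank ℂ S = d,
        ∃ x ∈ intrinsicInterior ℝ F, IsStabilizable L x,
        ∃ x ∈ intrinsicInterior ℝ F, IsStronglyStabilizable L x,
        ∃ X ∈ convexHull ℝ (inducedFields L), ∃ x ∈ intrinsicInterior ℝ F, IsTangent F (X *ᵥ x),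
        ∃ U ∈ unitaryGroup (Fin n) ℂ, ∃ x ∈ intrinsicInterior ℝ F,
          IsTangent F (inducedField L U *ᵥ x),
        ∃ H ρ : Matrix (Fin n) (Fin n) ℂ, IsState ρ ∧ ρ.rank = d ∧
          IsStabilizingHamiltonian H₀ V (supp ρ) H ∧ -(iAd H + L) ρ = 0 ∧
          ∀ σ : Matrix (Fin n) (Fin n) ℂ, IsState σ → supp σ ≤ supp ρ →
            -(iAd H + L) σ = 0 → σ = ρ]) := by
  subst hL
  obtain ⟨hd1, I, hcard, hFI⟩ := hF
  obtain rfl : F = face I := hFI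
  have hd : d ≠ 0 := by omega
  have hn0 : n ≠ 0 := by omega
  have hI : I.Nonempty := Finset.card_pos.1 (by omega)
  have hSU : ∀ {U : Matrix (Fin n) (Fin n) ℂ}, U ∈ specialUnitaryGroup (Fin n) ℂ →
      U ∈ unitaryGroup (Fin n) ℂ := fun h => (mem_specialUnitaryGroup_iff.1 h).1
  have lazy_of_convexHull : ∀ X ∈ convexHull ℝ (inducedFields (lindblad H₀ V)),
      ∀ x ∈ face I, (∀ i ∈ I, 0 < x i) → (∀ i ∉ I, (X *ᵥ x) i = 0) →
      ∃ S : Submodule ℂ (Fin n → ℂ), IsLazy V S ∧ Module.finrank ℂ S = d :=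
    fun X hX x hx hpos h => by
      obtain ⟨U, hU, hred⟩ := exists_reduces_of_convexHull hH₀ hX hx hpos h
      exact exists_isLazy_of_reduces hU hred hcard hd
  have h13 : IsViable (lindblad H₀ V) (face I) →
      ∃ S : Submodule ℂ (Fin n → ℂ), IsLazy V S ∧ Module.finrank ℂ S = d := fun h => by
    obtain ⟨X, hX, x, hx, hpos, h0⟩ := exists_mulVec_eq_zero_of_isViable hI h
    exact lazy_of_convexHull X hX x hx hpos h0
  have h21 : (∃ X ∈ convexHull ℝ (inducedFields (lindblad H₀ V)),
      FlowLeavesInvariant X (face I)) → IsViable (lindblad H₀ V) (face I) :=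
    fun ⟨X, hX, h⟩ => isViable_of_flow hX h
  have h38 : (∃ S : Submodule ℂ (Fin n → ℂ), IsLazy V S ∧ Module.finrank ℂ S = d) →
      ∃ H ρ : Matrix (Fin n) (Fin n) ℂ, IsState ρ ∧ ρ.rank = d ∧
        IsStabilizingHamiltonian H₀ V (supp ρ) H ∧ -(iAd H + lindblad H₀ V) ρ = 0 :=
    fun ⟨S, hS, hSd⟩ => by
      obtain ⟨E, hE, hV⟩ := exists_isometry_of_isLazy hS hSd
      obtain ⟨h, ρ, hh, hρ, htr, hfix⟩ := exists_fixed (fun k => Eᴴ * V k * E) hd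
      obtain ⟨H, R, h1, h2, h3, h4, -⟩ := exists_lift H₀ hH₀ hE hd hV hh hρ htr hfix
      exact ⟨H, R, h1, h2, h3, h4⟩
  have h8 : (∃ H ρ : Matrix (Fin n) (Fin n) ℂ, IsState ρ ∧ ρ.rank = d ∧
      IsStabilizingHamiltonian H₀ V (supp ρ) H ∧ -(iAd H + lindblad H₀ V) ρ = 0) →
      ∃ U ∈ specialUnitaryGroup (Fin n) ℂ, ∃ x ∈ face I, (∀ i ∈ I, 0 < x i) ∧
        inducedField (lindblad H₀ V) U *ᵥ x = 0 := fun ⟨H, ρ, hρ, hrank, hH, hfix⟩ =>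
    exists_stabilizable_of_fixed hn0 hH₀ hH.1 V hρ (hrank.trans hcard.symm) hfix
  have h85 : (∃ H ρ : Matrix (Fin n) (Fin n) ℂ, IsState ρ ∧ ρ.rank = d ∧
      IsStabilizingHamiltonian H₀ V (supp ρ) H ∧ -(iAd H + lindblad H₀ V) ρ = 0) →
      ∃ x ∈ intrinsicInterior ℝ (face I), IsStronglyStabilizable (lindblad H₀ V) x := fun h => by
    obtain ⟨U, hU, x, hx, hpos, h0⟩ := h8 h
    exact ⟨x, mem_intrinsicInterior_face hx hpos, hx.1, _, ⟨U, hU, rfl⟩, h0.symm⟩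
  have h82 : (∃ H ρ : Matrix (Fin n) (Fin n) ℂ, IsState ρ ∧ ρ.rank = d ∧
      IsStabilizingHamiltonian H₀ V (supp ρ) H ∧ -(iAd H + lindblad H₀ V) ρ = 0) →
      ∃ X ∈ convexHull ℝ (inducedFields (lindblad H₀ V)), FlowLeavesInvariant X (face I) :=
    fun h => by
      obtain ⟨U, hU, x, hx, hpos, h0⟩ := h8 h
      exact ⟨_, subset_convexHull ℝ _ ⟨U, hU, rfl⟩, flowLeavesInvariant_of_reduces hH₀ (hSU hU)
        (reduces_of_mulVec_eq_zero hH₀ (hSU hU) hx hpos fun i _ => by rw [h0]; rfl)⟩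
  have h54 : (∃ x ∈ intrinsicInterior ℝ (face I), IsStronglyStabilizable (lindblad H₀ V) x) →
      ∃ x ∈ intrinsicInterior ℝ (face I), IsStabilizable (lindblad H₀ V) x :=
    fun ⟨x, hx, hs, h0⟩ => ⟨x, hx, hs, subset_convexHull ℝ _ h0⟩
  have h57 : (∃ x ∈ intrinsicInterior ℝ (face I), IsStronglyStabilizable (lindblad H₀ V) x) →
      ∃ U ∈ unitaryGroup (Fin n) ℂ, ∃ x ∈ intrinsicInterior ℝ (face I),
        IsTangent (face I) (inducedField (lindblad H₀ V) U *ᵥ x) :=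
    fun ⟨x, hx, _, X, ⟨U, hU, hXU⟩, h0⟩ => by
      refine ⟨U, hSU hU, x, hx, ?_⟩
      rw [← hXU, ← h0]
      exact isTangent_zero _
  have h46 : (∃ x ∈ intrinsicInterior ℝ (face I), IsStabilizable (lindblad H₀ V) x) →
      ∃ X ∈ convexHull ℝ (inducedFields (lindblad H₀ V)), ∃ x ∈ intrinsicInterior ℝ (face I),
        IsTangent (face I) (X *ᵥ x) := fun ⟨x, hx, _, h0⟩ => by
    obtain ⟨X, hX, hXx⟩ := exists_mulVec_of_mem_convexHull_derv.1 h0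
    exact ⟨X, hX, x, hx, hXx ▸ isTangent_zero _⟩
  have h63 : (∃ X ∈ convexHull ℝ (inducedFields (lindblad H₀ V)),
      ∃ x ∈ intrinsicInterior ℝ (face I), IsTangent (face I) (X *ᵥ x)) →
      ∃ S : Submodule ℂ (Fin n → ℂ), IsLazy V S ∧ Module.finrank ℂ S = d :=
    fun ⟨X, hX, x, hx, ht⟩ => lazy_of_convexHull X hX x (intrinsicInterior_subset hx)
      (fun i hi => pos_of_mem_intrinsicInterior_face hx hi) fun i hi => eq_zero_of_isTangent ht hi
  have h73 : (∃ U ∈ unitaryGroup (Fin n) ℂ, ∃ x ∈ intrinsicInterior ℝ (face I),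
      IsTangent (face I) (inducedField (lindblad H₀ V) U *ᵥ x)) →
      ∃ S : Submodule ℂ (Fin n → ℂ), IsLazy V S ∧ Module.finrank ℂ S = d :=
    fun ⟨U, hU, x, hx, ht⟩ => exists_isLazy_of_reduces hU (reduces_of_mulVec_eq_zero hH₀ hU
      (intrinsicInterior_subset hx) (fun i hi => pos_of_mem_intrinsicInterior_face hx hi)
      fun i hi => eq_zero_of_isTangent ht hi) hcard hd
  refine ⟨?_, fun hPH => ?_⟩
  · tfae_have 1 → 3 := h13
    tfae_have 2 → 1 := h21
    tfae_have 3 → 8 := h38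
    tfae_have 8 → 5 := h85
    tfae_have 8 → 2 := h82
    tfae_have 5 → 4 := h54
    tfae_have 5 → 7 := h57
    tfae_have 4 → 6 := h46
    tfae_have 6 → 3 := h63
    tfae_have 7 → 3 := h73
    tfae_finish
  · have h88 : (∃ H ρ : Matrix (Fin n) (Fin n) ℂ, IsState ρ ∧ ρ.rank = d ∧
        IsStabilizingHamiltonian H₀ V (supp ρ) H ∧ -(iAd H + lindblad H₀ V) ρ = 0 ∧
        ∀ σ : Matrix (Fin n) (Fin n) ℂ, IsState σ → supp σ ≤ supp ρ →
          -(iAd H + lindblad H₀ V) σ = 0 → σ = ρ) →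
        ∃ H ρ : Matrix (Fin n) (Fin n) ℂ, IsState ρ ∧ ρ.rank = d ∧
          IsStabilizingHamiltonian H₀ V (supp ρ) H ∧ -(iAd H + lindblad H₀ V) ρ = 0 :=
      fun ⟨H, ρ, h1, h2, h3, h4, _⟩ => ⟨H, ρ, h1, h2, h3, h4⟩
    -- For `d ≥ 2` the given lazy subspace may be unsuitable, so it is discarded: it only serves to
    -- establish viability, without which failing to be purely Hamiltonian says nothing. The
    -- reducing unitary of a nonvanishing tangent field then provides a better subspace of the same
    -- dimension.
    have hE : (∃ S : Submodule ℂ (Fin n → ℂ), IsLazy V S ∧ Module.finrank ℂ S = d) →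
        ∃ (E : Matrix (Fin n) (Fin d) ℂ) (B : Fin r → Matrix (Fin d) (Fin d) ℂ), Eᴴ * E = 1 ∧
          (∀ k, V k * E = E * B k) ∧ (d = 1 ∨ ∃ k i j, i ≠ j ∧ B k i j ≠ 0) := fun h => by
      by_cases hd2 : d = 1
      · obtain ⟨S, hS, hSd⟩ := h
        obtain ⟨E, hE, hV⟩ := exists_isometry_of_isLazy hS hSd
        exact ⟨E, _, hE, hV, Or.inl hd2⟩
      · obtain ⟨U, hU, hred, k, i, hi, j, hj, hij, hne⟩ :=
          exists_offDiag_of_not_purelyHamiltonian hH₀ hI (h21 (h82 (h38 h)))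
            fun h => hPH ⟨by omega, h⟩
        obtain ⟨e, E, hE, hV⟩ := exists_isometry_of_reduces hU hred hcard
        refine ⟨E, _, hE, hV, Or.inr ⟨k, e.symm ⟨i, hi⟩, e.symm ⟨j, hj⟩, ?_, ?_⟩⟩
        · simpa using hij
        · simpa using hne
    tfae_have 1 → 3 := h13
    tfae_have 2 → 1 := h21
    tfae_have 3 → 8 := fun h => by
      obtain ⟨E, B, hE, hV, hB⟩ := hE h
      obtain ⟨h, ρ, hh, hρ, htr, hfix, huniq⟩ := exists_fixed_of_offDiag B hd hB
      obtain ⟨H, R, h1, h2, h3, h4, h5⟩ := exists_lift H₀ hH₀ hE hd hV hh hρ htr hfix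
      exact ⟨H, R, h1, h2, h3, h4, h5 huniq⟩
    tfae_have 8 → 5 := fun h => h85 (h88 h)
    tfae_have 8 → 2 := fun h => h82 (h88 h)
    tfae_have 5 → 4 := h54
    tfae_have 5 → 7 := h57
    tfae_have 4 → 6 := h46
    tfae_have 6 → 3 := h63
    tfae_have 7 → 3 := h73
    tfae_finish
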